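/- **Setting.** Let $\mathcal M$ be a $d$-dimensional compact (Hausdorff) smooth manifold with a fixed smooth atlas, and $\mu$ a Borel probability measure on $\mathcal M$, absolutely continuous with respect to Lebesgue measure in charts. A set $\Sigma\subset\mathbb R^d$ has Minkowski content zero if $\limsup_{\epsilon\to0}\mathrm{vol}(\Sigma(\epsilon))=0$, where $\Sigma(\epsilon)$ is its closed $\epsilon$-neighbourhood; a subset of $\mathcal M$ has Minkowski content zero if its image in every chart of the atlas has. Let $\Phi:\mathcal M\to\mathcal M$ be an invertible, $\mu$-preserving, piecewise smooth map: there are countably many pairwise disjoint open sets $\mathcal V_i$ with dense union such that each $\Phi|_{\mathcal V_i}$ extends smoothly to $\overline{\mathcal V_i}$ and $\mathcal S=\overline{\bigcup_i\partial\mathcal V_i}$ has Minkowski content zero. The domain of continuity of $\Phi^k$ $(k\ge1)$ is $\mathcal C_k=\{x:\Phi^j(x)\notin\mathcal S,\ 0\le j<k\}$. Let $\mathcal I\subset\mathbb N$ be infinite. All limits $N\to\infty$ are along $N\in\mathcal I$, and for sequences of $N\times N$ matrices $A_N\sim B_N$ means $\|A_N-B_N\|\to0$ in operator norm. Let $\mathrm{Op}_N:C^\infty(\mathcal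 M)\to M_N(\mathbb C)$ be linear maps such that for all $a,b\in C^\infty(\mathcal M)$ (complex valued) $$\mathrm{Op}_N(\bar a)\sim\mathrm{Op}_N(a)^\dagger,\quad \mathrm{Op}_N(a)\mathrm{Op}_N(b)\sim\mathrm{Op}_N(ab),\quad \tfrac1N\mathrm{Tr}\,\mathrm{Op}_N(a)\to\int_{\mathcal M}a\,d\mu .$$ Let $U_N$ be unitary $N\times N$ matrices with $U_N^{-1}\mathrm{Op}_N(a)U_N\sim\mathrm{Op}_N(a\circ\Phi)$ for every $a\in C^\infty(\mathcal M)$ such that the supports of $a$ and $a\circ\Phi$ lie in $\mathcal C_1$ (so that $a\circ\Phi$ is smooth). Let $\mathcal D_\nu\subset\mathcal M$ be an at most countable family of pairwise disjoint sets with boundary of Minkowski content zero, $n_\nu\ge1$ integers and $\alpha_\nu\in\mathbb R$, such that: (a) $\Phi^{n_\nu}|_{\mathcal D_\nu}=\mathrm{id}$, and for $0<|m|<n_\nu$ the fixed points of $\Phi^m$ on $\mathcal D_\nu$ form a set of Minkowski content zero; (b) for every integer $m\ne0$ the fixed points of $\Phi^m$ on $\mathcal D_0=\mathcal M\setminus\bigcup_\nu\mathcal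 D_\nu$ form a set of Minkowski content zero; (c) $U_N^{n_\nu}\mathrm{Op}_N(a)\sim e^{2\pi i n_\nu\alpha_\nu}\mathrm{Op}_N(a)$ for every $a\in C^\infty(\mathcal M)$ with support contained in $\mathcal D_\nu$ and in $\mathcal C_1,\dots,\mathcal C_{n_\nu}$. Suppose that $\Phi$ acts ergodically on $\mathcal D_0$ (with respect to $\mu|_{\mathcal D_0}$), and for each $N\in\mathcal I$ let $\varphi_1,\dots,\varphi_N$ (depending on $N$) be an orthonormal basis of $\mathbb C^N$ of eigenvectors of $U_N$. **Statement.** There are sets $I_N\subset\{1,\dots,N\}$ $(N\in\mathcal I)$ with $\lim_{N\to\infty}\#I_N/N=\mu(\mathcal D_0)$ such that for every $a\in C^\infty(\mathcal M)$ $$\langle\mathrm{Op}_N(a)\varphi_j,\varphi_j\rangle\to\frac1{\mu(\mathcal D_0)}\int_{\mathcal D_0}a\,d\mu\qquad(j\in I_N,\ N\to\infty),$$ uniformly in $j\in I_N$; the sets $I_N$ do not depend on $a$. (Here $\langle\cdot,\cdot\rangle$ is linear in its first entry; if $\mu(\mathcal D_0)=0$ the right-hand side is read as $0$.) -/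

import Mathlib

open Filter MeasureTheory
open scoped Manifold ContDiff Topology

noncomputable section

/-- The `*`-algebra `C^∞(M)` of complex valued smooth functions on a `d`-dimensional manifold. -/
def SmoothFun (d : ℕ) (M : Type*) [TopologicalSpace M]
    [ChartedSpace (EuclideanSpace ℝ (Fin d)) M] : StarSubalgebra ℂ (M → ℂ) where
  carrier := {f | ContMDiff (𝓡 d) 𝓘(ℝ, ℂ) ∞ f}
  mul_mem' := by
    intro f g hf hg x
    exact (contDiff_mul (𝕜 := ℝ) (𝔸 := ℂ) (n := ∞)).contMDiff.comp
      (hf.prodMk_space hg) x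
  add_mem' := by
    intro f g hf hg x
    exact (contDiff_add (𝕜 := ℝ) (F := ℂ) (n := ∞)).contMDiff.comp
      (hf.prodMk_space hg) x
  algebraMap_mem' := fun _ => contMDiff_const
  star_mem' := by
    intro f hf x
    exact (Complex.conjCLE.contDiff (n := ∞)).contMDiff.comp hf x

/-- The `s`-dimensional upper Minkowski content
`limsup_{ε → 0} (2ε)^{s-d} vol(Σ(ε))` of a subset `Σ` of `ℝ^d`, where
`Σ(ε)` is the closed `ε`-neighbourhood of `Σ`. -/
def upperMinkowskiContent {d : ℕ} (s : ℝ) (A : Set (EuclideanSpace ℝ (Fin d))) : ENNReal :=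
  limsup (fun ε : ℝ => ENNReal.ofReal ((2 * ε) ^ (s - d)) * volume (Metric.cthickening ε A))
    (𝓝[>] 0)

/-- A subset of a manifold has Minkowski content zero if its image in every chart of the
given atlas has `d`-dimensional upper Minkowski content zero. -/
def HasMinkowskiContentZero (d : ℕ) {M : Type*} [TopologicalSpace M]
    [ChartedSpace (EuclideanSpace ℝ (Fin d)) M] (A : Set M) : Prop :=
  ∀ e ∈ atlas (EuclideanSpace ℝ (Fin d)) M,
    upperMinkowskiContent (d : ℝ) (e '' (A ∩ e.source)) = 0

/-- A measure on a manifold is absolutely continuous with respect to Lebesgue measure if in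
every chart of the atlas it does not charge Lebesgue null sets. -/
def IsAbsContLebesgue (d : ℕ) {M : Type*} [TopologicalSpace M]
    [ChartedSpace (EuclideanSpace ℝ (Fin d)) M] [MeasurableSpace M] (μ : Measure M) : Prop :=
  ∀ e ∈ atlas (EuclideanSpace ℝ (Fin d)) M, ∀ A : Set (EuclideanSpace ℝ (Fin d)),
    volume A = 0 → μ (e.source ∩ e ⁻¹' A) = 0

/-- The domain of discontinuity attached to a partitioning `V` of `M`. -/
def discontinuityDomain {M κ : Type*} [TopologicalSpace M] (V : κ → Set M) : Set M :=
  closure (⋃ i, frontier (V i))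

/-- `Φ` is piecewise smooth with respect to the countable family `V` of open sets: the `V i` are
disjoint with dense union, the restriction of `Φ` to each `V i` is smooth up to the boundary
(i.e. agrees on `V i` with a map that is smooth on the closure of `V i`), and the domain of
discontinuity has Minkowski content zero. -/
structure IsPiecewiseSmooth (d : ℕ) {M κ : Type*} [TopologicalSpace M]
    [ChartedSpace (EuclideanSpace ℝ (Fin d)) M] (V : κ → Set M) (Φ : Equiv.Perm M) : Prop where
  isOpen : ∀ i, IsOpen (V i)
  disjoint : Pairwise fun i j => Disjoint (V i) (V j)
  dense : closure (⋃ i, V i) = Set.univ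
  smooth : ∀ i, ∃ Ψ : M → M,
    ContMDiffOn (𝓡 d) (𝓡 d) ∞ Ψ (closure (V i)) ∧ Set.EqOn Ψ Φ (V i)
  content : HasMinkowskiContentZero d (discontinuityDomain V)

/-- The domain of continuity of the iterate `Φ ^ k`: the points whose first `k` orbit points
`x, Φ x, …, Φ ^ (k - 1) x` lie in the domain of continuity of `Φ`, that is, outside the domain of
discontinuity. For `k = 1` this is the domain of continuity of `Φ` itself. -/
def continuityDomain {M κ : Type*} [TopologicalSpace M] (V : κ → Set M) (Φ : Equiv.Perm M)
    (k : ℕ) : Set M :=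
  {x | ∀ j < k, (Φ ^ j) x ∉ discontinuityDomain V}

/-- The filter `N → ∞` along an index set of positive integers. -/
def atTopIn (Idx : Set ℕ) : Filter ℕ := atTop ⊓ 𝓟 Idx

/-- Semiclassical equivalence `A ∼ B` of matrix sequences: `‖A_N - B_N‖ → 0` as `N → ∞` in the
index set, for the operator norm on euclidean `ℂ^N`. -/
def SemiclassicallyEquivalent (Idx : Set ℕ) (A B : ∀ N : ℕ, Matrix (Fin N) (Fin N) ℂ) : Prop :=
  Tendsto (fun N => ‖Matrix.toEuclideanCLM (𝕜 := ℂ) (A N - B N)‖) (atTopIn Idx) (𝓝 0)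

/-- The density of a sequence of sets `J_N ⊆ {1, …, N}` exists and equals `δ`. -/
def HasDensity (Idx : Set ℕ) (J : ∀ N : ℕ, Finset (Fin N)) (δ : ℝ) : Prop :=
  Tendsto (fun N : ℕ => ((J N).card : ℝ) / N) (atTopIn Idx) (𝓝 δ)

/-- The correspondence principle for quantum observables. -/
structure IsObservableQuantization (d : ℕ) {M : Type*} [TopologicalSpace M]
    [ChartedSpace (EuclideanSpace ℝ (Fin d)) M] [MeasurableSpace M] (μ : Measure M)
    (Idx : Set ℕ) (Op : ∀ N : ℕ, SmoothFun d M →ₗ[ℂ] Matrix (Fin N) (Fin N) ℂ) : Prop where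
  conj : ∀ a : SmoothFun d M,
    SemiclassicallyEquivalent Idx (fun N => Op N (star a)) (fun N => (Op N a).conjTranspose)
  mul : ∀ a b : SmoothFun d M,
    SemiclassicallyEquivalent Idx (fun N => Op N a * Op N b) (fun N => Op N (a * b))
  trace : ∀ a : SmoothFun d M,
    Tendsto (fun N : ℕ => (1 / (N : ℂ)) * (Op N a).trace) (atTopIn Idx)
      (𝓝 (∫ x, (a : M → ℂ) x ∂μ))

/-- The correspondence principle for quantum maps: `U⁻¹ Op(a) U ∼ Op(a ∘ Φ)` for smooth `a`
supported in the domain of continuity. It is only required when the support of `b = a ∘ Φ` lies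
there as well, which makes `a ∘ Φ` smooth, so that `Op(a ∘ Φ)` is meaningful. -/
def IsMapQuantization (d : ℕ) {M κ : Type*} [TopologicalSpace M]
    [ChartedSpace (EuclideanSpace ℝ (Fin d)) M] (V : κ → Set M) (Φ : Equiv.Perm M)
    (Idx : Set ℕ) (Op : ∀ N : ℕ, SmoothFun d M →ₗ[ℂ] Matrix (Fin N) (Fin N) ℂ)
    (U : ∀ N : ℕ, Matrix.unitaryGroup (Fin N) ℂ) : Prop :=
  ∀ a b : SmoothFun d M, (b : M → ℂ) = (a : M → ℂ) ∘ Φ →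
    tsupport (a : M → ℂ) ⊆ continuityDomain V Φ 1 →
    tsupport (b : M → ℂ) ⊆ continuityDomain V Φ 1 →
    SemiclassicallyEquivalent Idx
      (fun N => (((U N)⁻¹ : Matrix.unitaryGroup (Fin N) ℂ) : Matrix (Fin N) (Fin N) ℂ) *
        Op N a * (U N : Matrix (Fin N) (Fin N) ℂ))
      (fun N => Op N b)

/-- `e(z) = exp(2πiz)`. -/
def expTwoPiI (z : ℝ) : ℂ := Complex.exp (2 * Real.pi * Complex.I * z)

/-- Every `Φ ^ n_ν` is the identity on `D_ν`, the sets `D_ν` are disjoint with boundary of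
Minkowski content zero, and apart from this the periodic points of any given period form sets of
Minkowski content zero, both in the `D_ν` and in the complement `D_0` of their union. -/
structure IsPeriodicOn (d : ℕ) {M ι : Type*} [TopologicalSpace M]
    [ChartedSpace (EuclideanSpace ℝ (Fin d)) M] (Φ : Equiv.Perm M) (D : ι → Set M)
    (n : ι → ℕ) : Prop where
  disjoint : Pairwise fun ν ν' => Disjoint (D ν) (D ν')
  frontier : ∀ ν, HasMinkowskiContentZero d (frontier (D ν))
  pos : ∀ ν, 1 ≤ n ν
  periodic : ∀ ν, ∀ x ∈ D ν, (Φ ^ n ν) x = x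
  fixed : ∀ ν, ∀ m : ℤ, 0 < |m| → |m| < n ν →
    HasMinkowskiContentZero d {x | x ∈ D ν ∧ (Φ ^ m) x = x}
  fixed_compl : ∀ m : ℤ, m ≠ 0 →
    HasMinkowskiContentZero d {x | x ∈ (⋃ ν, D ν)ᶜ ∧ (Φ ^ m) x = x}

/-- The quantum counterpart of periodicity: `U ^ n_ν Op(a) ∼ e(n_ν α_ν) Op(a)` for smooth `a`
supported in `D_ν` and in the domains of continuity of `Φ, …, Φ ^ n_ν`. -/
def IsPeriodicQuantization (d : ℕ) {M κ ι : Type*} [TopologicalSpace M]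
    [ChartedSpace (EuclideanSpace ℝ (Fin d)) M] (V : κ → Set M) (Φ : Equiv.Perm M)
    (D : ι → Set M) (n : ι → ℕ) (α : ι → ℝ)
    (Idx : Set ℕ) (Op : ∀ N : ℕ, SmoothFun d M →ₗ[ℂ] Matrix (Fin N) (Fin N) ℂ)
    (U : ∀ N : ℕ, Matrix.unitaryGroup (Fin N) ℂ) : Prop :=
  ∀ ν, ∀ a : SmoothFun d M, tsupport (a : M → ℂ) ⊆ D ν →
    (∀ k, 1 ≤ k → k ≤ n ν → tsupport (a : M → ℂ) ⊆ continuityDomain V Φ k) →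
    SemiclassicallyEquivalent Idx
      (fun N => (U N : Matrix (Fin N) (Fin N) ℂ) ^ n ν * Op N a)
      (fun N => expTwoPiI (n ν * α ν) • Op N a)

end

noncomputable section

open scoped Matrix.Norms.L2Operator

/-! ### Root mean squares -/

/-! The engine is a duality principle, `eventually_seminorm_le_of_annihilator`. Let `r N` be
seminorms on the smooth functions that are asymptotically dominated by the `L²` norm. The functions
with `r N a → 0` form a subspace; if `f` lies in its `L²` closure, then `r N a` is asymptotically at
most `‖a - f‖`. By Hilbert space duality, `f` lies in this closure as soon as every `L²` function
`h` annihilating the subspace also annihilates `f`. Each semiclassical estimate thus becomes an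
almost everywhere statement about a single function `h`, and no averaging over time is needed.

The principle is used twice. For the normalised traces of `U ^ m Op(a)`, Egorov's property and
cyclicity of the trace show that all `g · (a ∘ Φ ^ m - a)` are null. Hence `h` vanishes off the
fixed points of `Φ ^ m`, in particular almost everywhere on `D₀`, and the traces are small for `a`
close to the indicator of `D₀` (`eventually_norm_trace_pow_mul_le`). With Fejér sums, an observable
`χ` close to that indicator is then small on average on eigenvectors whose eigenvalues lie near the
phases of finitely many periodic domains. Such eigenvectors therefore have asymptotic proportion at
most `1 - μ(D₀)`, up to a small error (`exists_eventually_card_filter_div_le`).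

For the root mean square of expectation values over the remaining eigenvectors, the null functions
include all `a ∘ Φ - a` with suitably supported `a`, and all functions supported in the good part of
one of the chosen periodic domains, because there `λ ^ n` stays away from the phase. So `h` is
invariant, constant on `D₀` by ergodicity, and zero on the chosen domains. An observable of mean
zero over `D₀` then has variance controlled by its mass on the unchosen domains, which have small
total measure (`eventually_variance_le`).

Chebyshev's inequality, a diagonal choice over a countable sup-dense family of observables, and a
trimming of the index sets to the exact density finish the proof. -/

/-- The root mean square over `J` of a vector indexed by `Fin N`, normalised by `N`. -/
def rootMeanSquare {N : ℕ} {E : Type*} [NormedAddCommGroup E] (J : Finset (Fin N))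
    (v : Fin N → E) : ℝ :=
  √((∑ j ∈ J, ‖v j‖ ^ 2) / N)

section RootMeanSquare

variable {N : ℕ} {E : Type*} [NormedAddCommGroup E]

theorem rootMeanSquare_eq_norm (J : Finset (Fin N)) (v : Fin N → E) :
    rootMeanSquare J v = ‖WithLp.toLp 2 (fun j : J => v j)‖ / √N := by
  rw [PiLp.norm_eq_of_L2, rootMeanSquare, Real.sqrt_div (by positivity)]
  congr 2
  exact (Finset.sum_coe_sort J (fun j => ‖v j‖ ^ 2)).symm

theorem rootMeanSquare_nonneg (J : Finset (Fin N)) (v : Fin N → E) : 0 ≤ rootMeanSquare J v :=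
  Real.sqrt_nonneg _

theorem rootMeanSquare_add_le (J : Finset (Fin N)) (v w : Fin N → E) :
    rootMeanSquare J (fun j => v j + w j) ≤ rootMeanSquare J v + rootMeanSquare J w := by
  simp only [rootMeanSquare_eq_norm]
  rw [← add_div]
  gcongr
  exact norm_add_le (WithLp.toLp 2 (fun j : J => v j)) (WithLp.toLp 2 (fun j : J => w j))

theorem rootMeanSquare_smul {𝕜 : Type*} [NormedField 𝕜] [NormedSpace 𝕜 E] (J : Finset (Fin N))
    (c : 𝕜) (v : Fin N → E) :
    rootMeanSquare J (fun j => c • v j) = ‖c‖ * rootMeanSquare J v := by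
  simp only [rootMeanSquare_eq_norm]
  rw [← mul_div_assoc, ← norm_smul c (WithLp.toLp 2 (fun j : J => v j))]
  rfl

theorem rootMeanSquare_mono {F : Type*} [NormedAddCommGroup F] {J J' : Finset (Fin N)}
    (hJ : J ⊆ J') {v : Fin N → E} {w : Fin N → F} (h : ∀ j ∈ J, ‖v j‖ ≤ ‖w j‖) :
    rootMeanSquare J v ≤ rootMeanSquare J' w := by
  refine Real.sqrt_le_sqrt ?_
  gcongr
  calc ∑ j ∈ J, ‖v j‖ ^ 2 ≤ ∑ j ∈ J, ‖w j‖ ^ 2 :=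
        Finset.sum_le_sum fun j hj => pow_le_pow_left₀ (norm_nonneg _) (h j hj) 2
    _ ≤ _ := Finset.sum_le_sum_of_subset_of_nonneg hJ fun _ _ _ => by positivity

/-- Cauchy–Schwarz. The factor `√(#J / N)` is kept because the eigenvalue count divides by it to
bound `#J / N` itself. -/
theorem sum_norm_div_le (J : Finset (Fin N)) (v : Fin N → E) :
    (∑ j ∈ J, ‖v j‖) / N ≤ √((J.card : ℝ) / N) * rootMeanSquare J v := by
  rw [rootMeanSquare, ← Real.sqrt_mul (by positivity)]
  refine Real.le_sqrt_of_sq_le ?_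
  have := sq_sum_le_card_mul_sum_sq (s := J) (f := fun j => ‖v j‖)
  rw [div_pow, div_mul_div_comm, ← sq (N : ℝ)]
  gcongr

/-- Chebyshev's inequality. -/
theorem card_filter_le_div_le (J : Finset (Fin N)) (v : Fin N → E) {ε : ℝ} (hε : 0 < ε) :
    ((J.filter fun j => ε ≤ ‖v j‖).card : ℝ) / N ≤ (rootMeanSquare J v / ε) ^ 2 := by
  rw [div_pow, rootMeanSquare, Real.sq_sqrt (by positivity), le_div_iff₀ (by positivity),
    div_mul_eq_mul_div]
  gcongr
  rw [← nsmul_eq_mul, ← Finset.sum_const]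
  calc ∑ j ∈ J.filter fun j => ε ≤ ‖v j‖, ε ^ 2 ≤ ∑ j ∈ J.filter fun j => ε ≤ ‖v j‖, ‖v j‖ ^ 2 :=
        Finset.sum_le_sum fun j hj => pow_le_pow_left₀ hε.le (Finset.mem_filter.1 hj).2 2
    _ ≤ _ := Finset.sum_le_sum_of_subset_of_nonneg (Finset.filter_subset _ _)
        fun _ _ _ => by positivity

end RootMeanSquare

/-! ### Matrices in an orthonormal basis -/

section Matrix

variable {N : ℕ} (φ : OrthonormalBasis (Fin N) ℂ (EuclideanSpace ℂ (Fin N)))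

/-- The expectation value of a matrix in a state of an orthonormal basis. -/
def expectation (A : Matrix (Fin N) (Fin N) ℂ) (j : Fin N) : ℂ :=
  inner ℂ (φ j) (Matrix.toEuclideanCLM (𝕜 := ℂ) A (φ j))

/-- The normalised Hilbert-Schmidt norm. -/
def hsNorm (A : Matrix (Fin N) (Fin N) ℂ) : ℝ :=
  rootMeanSquare Finset.univ fun j => Matrix.toEuclideanCLM (𝕜 := ℂ) A (φ j)

theorem expectation_add (A B : Matrix (Fin N) (Fin N) ℂ) (j : Fin N) :
    expectation φ (A + B) j = expectation φ A j + expectation φ B j := by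
  simp [expectation]

theorem expectation_sub (A B : Matrix (Fin N) (Fin N) ℂ) (j : Fin N) :
    expectation φ (A - B) j = expectation φ A j - expectation φ B j := by
  simp [expectation]

theorem expectation_smul (c : ℂ) (A : Matrix (Fin N) (Fin N) ℂ) (j : Fin N) :
    expectation φ (c • A) j = c * expectation φ A j := by
  simp [expectation]

theorem expectation_one (j : Fin N) : expectation φ 1 j = 1 := by
  simp [expectation]

theorem norm_expectation_le (A : Matrix (Fin N) (Fin N) ℂ) (j : Fin N) :
    ‖expectation φ A j‖ ≤ ‖Matrix.toEuclideanCLM (𝕜 := ℂ) A (φ j)‖ := by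
  refine (norm_inner_le_norm _ _).trans ?_
  simp

theorem norm_toEuclideanCLM_apply_le (A : Matrix (Fin N) (Fin N) ℂ) (j : Fin N) :
    ‖Matrix.toEuclideanCLM (𝕜 := ℂ) A (φ j)‖ ≤ ‖A‖ := by
  refine ((Matrix.toEuclideanCLM (𝕜 := ℂ) A).le_opNorm _).trans ?_
  simp [Matrix.cstar_norm_def]

theorem norm_expectation_le_norm (A : Matrix (Fin N) (Fin N) ℂ) (j : Fin N) :
    ‖expectation φ A j‖ ≤ ‖A‖ :=
  (norm_expectation_le φ A j).trans (norm_toEuclideanCLM_apply_le φ A j)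

theorem inner_toEuclideanCLM_conjTranspose (A : Matrix (Fin N) (Fin N) ℂ)
    (v w : EuclideanSpace ℂ (Fin N)) :
    inner ℂ v (Matrix.toEuclideanCLM (𝕜 := ℂ) A.conjTranspose w) =
      inner ℂ (Matrix.toEuclideanCLM (𝕜 := ℂ) A v) w := by
  have h : Matrix.toEuclideanCLM (𝕜 := ℂ) A.conjTranspose =
      ContinuousLinearMap.adjoint (Matrix.toEuclideanCLM (𝕜 := ℂ) A) :=
    map_star (Matrix.toEuclideanCLM (𝕜 := ℂ)) A
  rw [h, ContinuousLinearMap.adjoint_inner_right]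

theorem expectation_conjTranspose_mul_self (A : Matrix (Fin N) (Fin N) ℂ) (j : Fin N) :
    expectation φ (A.conjTranspose * A) j =
      ((‖Matrix.toEuclideanCLM (𝕜 := ℂ) A (φ j)‖ ^ 2 : ℝ) : ℂ) := by
  rw [expectation, map_mul, mul_apply_eq_comp, inner_toEuclideanCLM_conjTranspose,
    inner_self_eq_norm_sq_to_K]
  norm_cast

theorem trace_eq_sum_expectation (A : Matrix (Fin N) (Fin N) ℂ) :
    A.trace = ∑ j, expectation φ A j := by
  have h := LinearMap.trace_eq_sum_inner
    (Matrix.toEuclideanCLM (𝕜 := ℂ) A : EuclideanSpace ℂ (Fin N) →ₗ[ℂ] _) φ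
  simp only [ContinuousLinearMap.coe_coe] at h
  simp only [expectation]
  rw [← h, Matrix.coe_toEuclideanCLM_eq_toEuclideanLin, Matrix.toEuclideanLin_eq_toLin_orthonormal,
    Matrix.trace_toLin_eq]

theorem norm_normalised_trace_le (A : Matrix (Fin N) (Fin N) ℂ) :
    ‖(1 / (N : ℂ)) * A.trace‖ ≤ ‖A‖ := by
  rcases Nat.eq_zero_or_pos N with h | h
  · subst h
    simp
  rw [trace_eq_sum_expectation (EuclideanSpace.basisFun (Fin N) ℂ), norm_mul, norm_div, norm_one,
    Complex.norm_natCast, one_div, inv_mul_le_iff₀ (by positivity)]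
  refine (norm_sum_le_of_le _ fun j _ => norm_expectation_le_norm _ A j).trans ?_
  simp

/-- The right-hand side does not involve the basis: the limit of `hsNorm` comes from the trace
axiom, while `hsNorm` controls mean values in the eigenbasis. -/
theorem hsNorm_sq (A : Matrix (Fin N) (Fin N) ℂ) :
    ((hsNorm φ A ^ 2 : ℝ) : ℂ) = (1 / (N : ℂ)) * (A.conjTranspose * A).trace := by
  rw [hsNorm, rootMeanSquare, Real.sq_sqrt (by positivity), trace_eq_sum_expectation φ]
  simp only [expectation_conjTranspose_mul_self]
  push_cast
  ring

theorem hsNorm_nonneg (A : Matrix (Fin N) (Fin N) ℂ) : 0 ≤ hsNorm φ A :=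
  rootMeanSquare_nonneg _ _

theorem rootMeanSquare_expectation_le (J : Finset (Fin N)) (A : Matrix (Fin N) (Fin N) ℂ) :
    rootMeanSquare J (expectation φ A) ≤ hsNorm φ A :=
  rootMeanSquare_mono (Finset.subset_univ _) fun j _ => norm_expectation_le φ A j

variable {φ} {U : Matrix.unitaryGroup (Fin N) ℂ} {lam : Fin N → ℂ}

theorem toEuclideanCLM_pow_apply
    (hU : ∀ j, Matrix.toEuclideanCLM (𝕜 := ℂ) (U : Matrix (Fin N) (Fin N) ℂ) (φ j) = lam j • φ j)
    (m : ℕ) (j : Fin N) :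
    Matrix.toEuclideanCLM (𝕜 := ℂ) ((U : Matrix (Fin N) (Fin N) ℂ) ^ m) (φ j) =
      lam j ^ m • φ j := by
  induction m with
  | zero => simp
  | succ m ih =>
    rw [pow_succ, map_mul, mul_apply_eq_comp, hU, map_smul, ih, smul_smul, pow_succ,
      mul_comm]

/-- An eigenvector of a unitary matrix is also an eigenvector of its adjoint, with the conjugate
eigenvalue, so powers of `U` can be peeled off on the left as well. -/
theorem expectation_pow_mul (hlam : ∀ j, ‖lam j‖ = 1)
    (hU : ∀ j, Matrix.toEuclideanCLM (𝕜 := ℂ) (U : Matrix (Fin N) (Fin N) ℂ) (φ j) = lam j • φ j)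
    (m : ℕ) (A : Matrix (Fin N) (Fin N) ℂ) (j : Fin N) :
    expectation φ ((U : Matrix (Fin N) (Fin N) ℂ) ^ m * A) j = lam j ^ m * expectation φ A j := by
  have h1 : ((U : Matrix (Fin N) (Fin N) ℂ) ^ m).conjTranspose *
      (U : Matrix (Fin N) (Fin N) ℂ) ^ m = 1 := by
    have := Unitary.coe_star_mul_self (U ^ m)
    simpa [Matrix.star_eq_conjTranspose] using this
  have h2 := congrArg (fun v => inner ℂ v (Matrix.toEuclideanCLM (𝕜 := ℂ)
    ((U : Matrix (Fin N) (Fin N) ℂ) ^ m * A) (φ j))) (toEuclideanCLM_pow_apply hU m j)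
  simp only [inner_smul_left] at h2
  rw [← inner_toEuclideanCLM_conjTranspose, ← mul_apply_eq_comp, ← map_mul,
    ← mul_assoc, h1, one_mul] at h2
  have h3 : lam j ^ m * (starRingEnd ℂ) (lam j ^ m) = 1 := by
    rw [Complex.mul_conj, Complex.normSq_eq_norm_sq]
    simp [hlam]
  rw [expectation, expectation, h2, ← mul_assoc, h3, one_mul]

end Matrix

/-! ### Fejér sums -/

/-- Since `‖z ^ k - 1‖ ≤ k ‖z - 1‖ ≤ 1/2` for `k ≤ K`, the geometric sum stays within `K / 2` of
`K`. -/
theorem half_le_norm_sum_pow {z : ℂ} (hz : ‖z‖ = 1) {K : ℕ} (h : ‖z - 1‖ * (2 * K) ≤ 1) :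
    (K : ℝ) / 2 ≤ ‖∑ k ∈ Finset.range K, z ^ k‖ := by
  have h1 : ∀ k : ℕ, ‖z ^ k - 1‖ ≤ k * ‖z - 1‖ := by
    intro k
    induction k with
    | zero => simp
    | succ k ih =>
      calc ‖z ^ (k + 1) - 1‖ = ‖z * (z ^ k - 1) + (z - 1)‖ := by ring_nf
        _ ≤ ‖z * (z ^ k - 1)‖ + ‖z - 1‖ := norm_add_le _ _
        _ ≤ k * ‖z - 1‖ + ‖z - 1‖ := by rw [norm_mul, hz, one_mul]; gcongr
        _ = _ := by push_cast; ring
  have h2 : ‖∑ k ∈ Finset.range K, (z ^ k - 1)‖ ≤ K / 2 := by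
    refine (norm_sum_le_of_le (n := fun _ => (1 / 2 : ℝ)) _ fun k hk => ?_).trans ?_
    · refine (h1 k).trans ?_
      have : (k : ℝ) ≤ K := by exact_mod_cast (Finset.mem_range.1 hk).le
      nlinarith [norm_nonneg (z - 1)]
    · simp; linarith
  have h3 : ∑ k ∈ Finset.range K, z ^ k = K + ∑ k ∈ Finset.range K, (z ^ k - 1) := by
    simp
  rw [h3]
  have h4 := norm_sub_le_norm_add (K : ℂ) (∑ k ∈ Finset.range K, (z ^ k - 1))
  rw [Complex.norm_natCast] at h4
  linarith

/-- Expanding the square gives moments of order `k - l`; for real weights a negative moment is the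
conjugate of a positive one. In truncated subtraction the exponent `(k - l) + (l - k)` is `|k - l|`.
-/
theorem sum_mul_norm_sum_pow_sq_le {N : ℕ} (q : Fin N → ℝ) {z : Fin N → ℂ}
    (hz : ∀ j, ‖z j‖ = 1) (K : ℕ) :
    ∑ j, q j * ‖∑ k ∈ Finset.range K, z j ^ k‖ ^ 2 ≤
      ∑ k ∈ Finset.range K, ∑ l ∈ Finset.range K,
        ‖∑ j, (q j : ℂ) * z j ^ ((k - l) + (l - k))‖ := by
  have hzz : ∀ j, z j * (starRingEnd ℂ) (z j) = 1 := fun j => by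
    rw [Complex.mul_conj, Complex.normSq_eq_norm_sq, hz]; simp
  have h1 : ((∑ j, q j * ‖∑ k ∈ Finset.range K, z j ^ k‖ ^ 2 : ℝ) : ℂ) =
      ∑ k ∈ Finset.range K, ∑ l ∈ Finset.range K,
        ∑ j, (q j : ℂ) * (z j ^ k * (starRingEnd ℂ) (z j) ^ l) := by
    push_cast
    simp_rw [← Complex.mul_conj', map_sum, map_pow, Finset.sum_mul_sum, Finset.mul_sum]
    rw [Finset.sum_comm]
    exact Finset.sum_congr rfl fun k _ => Finset.sum_comm
  refine (Complex.re_le_norm _).trans' (le_of_eq (Complex.ofReal_re _).symm) |>.trans ?_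
  rw [h1]
  refine norm_sum_le_of_le _ fun k _ => norm_sum_le_of_le _ fun l _ => ?_
  rcases le_total l k with h | h
  · obtain ⟨m, rfl⟩ := Nat.exists_eq_add_of_le h
    refine le_of_eq (congrArg _ (Finset.sum_congr rfl fun j _ => ?_))
    rw [show l + m - l + (l - (l + m)) = m by omega, pow_add, mul_comm (z j ^ l), mul_assoc (z j ^ m),
      ← mul_pow, hzz, one_pow, mul_one]
  · obtain ⟨m, rfl⟩ := Nat.exists_eq_add_of_le h
    rw [← Complex.norm_conj, map_sum]
    refine le_of_eq (congrArg _ (Finset.sum_congr rfl fun j _ => ?_))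
    rw [show k - (k + m) + (k + m - k) = m by omega]
    simp only [map_mul, map_pow, Complex.conj_ofReal, Complex.conj_conj]
    rw [pow_add, ← mul_assoc ((starRingEnd ℂ) (z j) ^ k), ← mul_pow, mul_comm _ (z j), hzz, one_pow,
      one_mul]

/-! ### Semiclassical equivalence -/

theorem eventually_ne_zero_atTopIn (Idx : Set ℕ) : ∀ᶠ N in atTopIn Idx, N ≠ 0 :=
  (eventually_ne_atTop 0).filter_mono inf_le_left

theorem eventually_mem_atTopIn (Idx : Set ℕ) : ∀ᶠ N in atTopIn Idx, N ∈ Idx :=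
  Eventually.filter_mono inf_le_right (eventually_principal.2 fun _ h => h)

/-- A sequence of matrices is bounded in operator norm along the index set. -/
def IsBoundedSequence (Idx : Set ℕ) (A : ∀ N : ℕ, Matrix (Fin N) (Fin N) ℂ) : Prop :=
  ∃ C : ℝ, ∀ᶠ N in atTopIn Idx, ‖A N‖ ≤ C

namespace SemiclassicallyEquivalent

variable {Idx : Set ℕ} {A B C : ∀ N : ℕ, Matrix (Fin N) (Fin N) ℂ}

theorem tendsto (h : SemiclassicallyEquivalent Idx A B) :
    Tendsto (fun N => ‖A N - B N‖) (atTopIn Idx) (𝓝 0) := h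

theorem of_le {g : ℕ → ℝ} (hg : Tendsto g (atTopIn Idx) (𝓝 0))
    (h : ∀ᶠ N in atTopIn Idx, ‖A N - B N‖ ≤ g N) : SemiclassicallyEquivalent Idx A B :=
  squeeze_zero' (Eventually.of_forall fun _ => norm_nonneg _) h hg

theorem symm (h : SemiclassicallyEquivalent Idx A B) : SemiclassicallyEquivalent Idx B A :=
  of_le h.tendsto (Eventually.of_forall fun _ => (norm_sub_rev _ _).le)

theorem trans (h : SemiclassicallyEquivalent Idx A B) (h' : SemiclassicallyEquivalent Idx B C) :
    SemiclassicallyEquivalent Idx A C := by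
  refine of_le (g := fun N => ‖A N - B N‖ + ‖B N - C N‖) ?_
    (Eventually.of_forall fun _ => norm_sub_le_norm_sub_add_norm_sub _ _ _)
  simpa using h.tendsto.add h'.tendsto

theorem mul_left (h : SemiclassicallyEquivalent Idx A B) (hC : IsBoundedSequence Idx C) :
    SemiclassicallyEquivalent Idx (fun N => C N * A N) (fun N => C N * B N) := by
  obtain ⟨c, hc⟩ := hC
  refine of_le (g := fun N => c * ‖A N - B N‖) (by simpa using h.tendsto.const_mul c) ?_
  filter_upwards [hc] with N hN
  rw [← mul_sub]
  exact (norm_mul_le _ _).trans (by gcongr)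

theorem mul_right (h : SemiclassicallyEquivalent Idx A B) (hC : IsBoundedSequence Idx C) :
    SemiclassicallyEquivalent Idx (fun N => A N * C N) (fun N => B N * C N) := by
  obtain ⟨c, hc⟩ := hC
  refine of_le (g := fun N => ‖A N - B N‖ * c) (by simpa using h.tendsto.mul_const c) ?_
  filter_upwards [hc] with N hN
  rw [← sub_mul]
  exact (norm_mul_le _ _).trans (by gcongr)

theorem tendsto_trace_sub (h : SemiclassicallyEquivalent Idx A B) :
    Tendsto (fun N : ℕ => (1 / (N : ℂ)) * (A N).trace - (1 / (N : ℂ)) * (B N).trace)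
      (atTopIn Idx) (𝓝 0) := by
  refine squeeze_zero_norm (fun N => ?_) h.tendsto
  rw [← mul_sub, ← Matrix.trace_sub]
  exact norm_normalised_trace_le _

end SemiclassicallyEquivalent

theorem norm_unitaryGroup_pow_le {N : ℕ} (U : Matrix.unitaryGroup (Fin N) ℂ) (m : ℕ) :
    ‖(U : Matrix (Fin N) (Fin N) ℂ) ^ m‖ ≤ 1 := by
  have h1 : ((U : Matrix (Fin N) (Fin N) ℂ) ^ m).conjTranspose *
      (U : Matrix (Fin N) (Fin N) ℂ) ^ m = 1 := by
    simpa [Matrix.star_eq_conjTranspose] using Unitary.coe_star_mul_self (U ^ m)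
  have h2 := Matrix.l2_opNorm_conjTranspose_mul_self ((U : Matrix (Fin N) (Fin N) ℂ) ^ m)
  have h3 : ‖(1 : Matrix (Fin N) (Fin N) ℂ)‖ ≤ 1 := by
    rw [Matrix.cstar_norm_def, map_one]
    exact ContinuousLinearMap.norm_id_le
  rw [h1] at h2
  nlinarith [norm_nonneg ((U : Matrix (Fin N) (Fin N) ℂ) ^ m)]

theorem isBoundedSequence_unitaryGroup_pow (Idx : Set ℕ) (U : ∀ N : ℕ, Matrix.unitaryGroup (Fin N) ℂ)
    (m : ℕ) : IsBoundedSequence Idx fun N => (U N : Matrix (Fin N) (Fin N) ℂ) ^ m :=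
  ⟨1, Eventually.of_forall fun _ => norm_unitaryGroup_pow_le _ _⟩

/-- Both summands on the right are positive semidefinite, so the quadratic form of the sum at `v`
dominates `‖A v‖ ^ 2`. -/
theorem norm_sq_le_norm_conjTranspose_mul_self_add {N : ℕ} (A B : Matrix (Fin N) (Fin N) ℂ) :
    ‖A‖ ^ 2 ≤ ‖A.conjTranspose * A + B.conjTranspose * B‖ := by
  set S := A.conjTranspose * A + B.conjTranspose * B with hS
  refine (Real.le_sqrt (norm_nonneg _) (norm_nonneg _)).1 ?_
  rw [Matrix.cstar_norm_def A]
  refine ContinuousLinearMap.opNorm_le_bound _ (Real.sqrt_nonneg _) fun v => ?_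
  refine (sq_le_sq₀ (norm_nonneg _) (by positivity)).1 ?_
  rw [mul_pow, Real.sq_sqrt (norm_nonneg _)]
  have h1 : ∀ A : Matrix (Fin N) (Fin N) ℂ,
      inner ℂ v (Matrix.toEuclideanCLM (𝕜 := ℂ) (A.conjTranspose * A) v) =
        ((‖Matrix.toEuclideanCLM (𝕜 := ℂ) A v‖ ^ 2 : ℝ) : ℂ) := fun A => by
    rw [map_mul, mul_apply_eq_comp, inner_toEuclideanCLM_conjTranspose, inner_self_eq_norm_sq_to_K]
    norm_cast
  have h2 : ‖inner ℂ v (Matrix.toEuclideanCLM (𝕜 := ℂ) S v)‖ ≤ ‖v‖ * (‖S‖ * ‖v‖) :=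
    (norm_inner_le_norm _ _).trans (by gcongr; exact ContinuousLinearMap.le_opNorm _ _)
  rw [hS, map_add, add_apply, inner_add_right, h1, h1, ← Complex.ofReal_add,
    Complex.norm_real, Real.norm_of_nonneg (by positivity)] at h2
  nlinarith [sq_nonneg ‖Matrix.toEuclideanCLM (𝕜 := ℂ) B v‖]

/-! ### The observables -/

section Observables

variable {d : ℕ} {M : Type*} [TopologicalSpace M] [ChartedSpace (EuclideanSpace ℝ (Fin d)) M]

theorem SmoothFun.contMDiff (a : SmoothFun d M) :
    ContMDiff (𝓡 d) 𝓘(ℝ, ℂ) ∞ (a : M → ℂ) := a.2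

theorem SmoothFun.continuous (a : SmoothFun d M) : Continuous (a : M → ℂ) :=
  (contMDiff a).continuous

theorem SmoothFun.exists_norm_lt [CompactSpace M] (a : SmoothFun d M) :
    ∃ c : ℝ, 0 < c ∧ ∀ x, ‖(a : M → ℂ) x‖ < c := by
  obtain ⟨c, hc⟩ := (isCompact_range (continuous a).norm).bddAbove
  refine ⟨|c| + 1, by positivity, fun x => ?_⟩
  have := hc (Set.mem_range_self x)
  have := le_abs_self c
  linarith

/-- The witness is `√(c² - |a|²)`; the strict bound on `|a|` keeps the radicand positive and hence
the root smooth. -/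
theorem SmoothFun.exists_star_mul_add_mul_self (a : SmoothFun d M) {c : ℝ}
    (hc : ∀ x, ‖(a : M → ℂ) x‖ < c) :
    ∃ b : SmoothFun d M, star b = b ∧
      star a * a + star b * b = ((c : ℂ) ^ 2) • (1 : SmoothFun d M) := by
  have hpos : ∀ x, 0 < c ^ 2 - ‖(a : M → ℂ) x‖ ^ 2 := fun x =>
    sub_pos.2 (pow_lt_pow_left₀ (hc x) (norm_nonneg _) two_ne_zero)
  have hb : ContMDiff (𝓡 d) 𝓘(ℝ, ℂ) ∞ fun x => ((√(c ^ 2 - ‖(a : M → ℂ) x‖ ^ 2) : ℝ) : ℂ) := by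
    intro x
    have h1 : ContDiffAt ℝ ∞ (fun z : ℂ => ((√(c ^ 2 - ‖z‖ ^ 2) : ℝ) : ℂ)) ((a : M → ℂ) x) :=
      Complex.ofRealCLM.contDiff.contDiffAt.comp _
        ((contDiff_const.sub (contDiff_norm_sq ℝ)).contDiffAt.sqrt (hpos x).ne')
    exact h1.contMDiffAt.comp x (contMDiff a x)
  refine ⟨⟨_, hb⟩, ?_, ?_⟩
  · ext x
    simp
  · ext x
    have h2 : (starRingEnd ℂ) ((a : M → ℂ) x) * (a : M → ℂ) x = ((‖(a : M → ℂ) x‖ ^ 2 : ℝ) : ℂ) := by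
      rw [Complex.conj_mul']; norm_cast
    have h3 : ((√(c ^ 2 - ‖(a : M → ℂ) x‖ ^ 2) : ℝ) : ℂ) * ((√(c ^ 2 - ‖(a : M → ℂ) x‖ ^ 2) : ℝ) : ℂ) =
        ((c ^ 2 - ‖(a : M → ℂ) x‖ ^ 2 : ℝ) : ℂ) := by
      rw [← Complex.ofReal_mul, Real.mul_self_sqrt (hpos x).le]
    simp [h2, h3]

variable [MeasurableSpace M] {μ : Measure M} {Idx : Set ℕ}
  {Op : ∀ N : ℕ, SmoothFun d M →ₗ[ℂ] Matrix (Fin N) (Fin N) ℂ}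

namespace IsObservableQuantization

variable (hOp : IsObservableQuantization d μ Idx Op)
include hOp

/-- `Op N 1` is not assumed to be the identity, but it is almost a self-adjoint idempotent. The
C*-identity turns this into the quadratic inequality `x² ≤ (3/2) x + 1/2` for its norm. -/
theorem eventually_norm_one_le : ∀ᶠ N in atTopIn Idx, ‖Op N 1‖ ≤ 2 := by
  have h1 := (hOp.conj 1).tendsto.eventually (gt_mem_nhds (show (0 : ℝ) < 1 / 2 by norm_num))
  have h2 := (hOp.mul 1 1).tendsto.eventually (gt_mem_nhds (show (0 : ℝ) < 1 / 2 by norm_num))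
  filter_upwards [h1, h2] with N h1 h2
  rw [star_one, norm_sub_rev] at h1
  rw [one_mul] at h2
  set P := Op N 1
  have h3 : ‖P‖ * ‖P‖ ≤ 1 / 2 * ‖P‖ + 1 / 2 + ‖P‖ := by
    rw [← Matrix.l2_opNorm_conjTranspose_mul_self,
      show P.conjTranspose * P = (P.conjTranspose - P) * P + (P * P - P) + P by noncomm_ring]
    refine norm_add₃_le.trans ?_
    gcongr
    exact (norm_mul_le _ _).trans (by gcongr)
  nlinarith [norm_nonneg P]

/-- With `|a|² + |b|² = c²`, the matrix `A†A + B†B` is close to `c² Op(1)`, which bounds both norms.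
The errors themselves contain `‖A‖` and `‖B‖`, so a quadratic inequality has to be solved; the
constant 5 is not sharp. Only linearity in the sup bound matters, as it makes `Op` stable under
uniform approximation. -/
theorem eventually_norm_le (a : SmoothFun d M) {c : ℝ} (hc0 : 0 < c)
    (hc : ∀ x, ‖(a : M → ℂ) x‖ < c) : ∀ᶠ N in atTopIn Idx, ‖Op N a‖ ≤ 5 * c := by
  obtain ⟨b, hb, hab⟩ := SmoothFun.exists_star_mul_add_mul_self a hc
  have key : ∀ a : SmoothFun d M, ∀ᶠ N in atTopIn Idx,
      ‖(Op N a).conjTranspose * Op N a - Op N (star a * a)‖ ≤ c * ‖Op N a‖ + c ^ 2 := by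
    intro a
    have h1 := (hOp.conj a).tendsto.eventually (gt_mem_nhds hc0)
    have h2 := (hOp.mul (star a) a).tendsto.eventually (gt_mem_nhds (show 0 < c ^ 2 by positivity))
    filter_upwards [h1, h2] with N h1 h2
    rw [norm_sub_rev] at h1
    set A := Op N a
    rw [show A.conjTranspose * A - Op N (star a * a) = (A.conjTranspose - Op N (star a)) * A +
      (Op N (star a) * A - Op N (star a * a)) by noncomm_ring]
    refine (norm_add_le _ _).trans ?_
    gcongr
    exact (norm_mul_le _ _).trans (by gcongr)
  filter_upwards [key a, key b, hOp.eventually_norm_one_le] with N ha hb h1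
  have h2 : ‖Op N (star a * a) + Op N (star b * b)‖ ≤ c ^ 2 * 2 := by
    rw [← map_add, hab, map_smul, norm_smul]
    simp only [norm_pow, Complex.norm_real, Real.norm_eq_abs, sq_abs]
    gcongr
  set A := Op N a
  set B := Op N b
  have h3 : ‖A.conjTranspose * A + B.conjTranspose * B‖ ≤
      (c * ‖A‖ + c ^ 2) + (c * ‖B‖ + c ^ 2) + c ^ 2 * 2 := by
    rw [show A.conjTranspose * A + B.conjTranspose * B =
      (A.conjTranspose * A - Op N (star a * a)) + (B.conjTranspose * B - Op N (star b * b)) +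
      (Op N (star a * a) + Op N (star b * b)) by abel]
    refine norm_add₃_le.trans ?_
    gcongr
  have h4 := norm_sq_le_norm_conjTranspose_mul_self_add A B
  have h5 := norm_sq_le_norm_conjTranspose_mul_self_add B A
  rw [add_comm] at h5
  by_contra! h
  nlinarith [norm_nonneg A, norm_nonneg B, sq_nonneg (‖B‖ - c)]

theorem isBoundedSequence [CompactSpace M] (a : SmoothFun d M) :
    IsBoundedSequence Idx fun N => Op N a := by
  obtain ⟨c, hc0, hc⟩ := SmoothFun.exists_norm_lt a
  exact ⟨_, hOp.eventually_norm_le a hc0 hc⟩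

theorem conjTranspose_mul_self [CompactSpace M] (a : SmoothFun d M) :
    SemiclassicallyEquivalent Idx (fun N => (Op N a).conjTranspose * Op N a)
      (fun N => Op N (star a * a)) :=
  ((hOp.conj a).symm.mul_right (hOp.isBoundedSequence a)).trans (hOp.mul (star a) a)

theorem tendsto_hsNorm_sq [CompactSpace M] (a : SmoothFun d M)
    (φ : ∀ N : ℕ, OrthonormalBasis (Fin N) ℂ (EuclideanSpace ℂ (Fin N))) :
    Tendsto (fun N => hsNorm (φ N) (Op N a) ^ 2) (atTopIn Idx)
      (𝓝 (∫ x, ‖(a : M → ℂ) x‖ ^ 2 ∂μ)) := by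
  have h1 := (hOp.conjTranspose_mul_self a).tendsto_trace_sub.add (hOp.trace (star a * a))
  simp only [sub_add_cancel, zero_add, ← hsNorm_sq (φ _)] at h1
  have h2 : ∫ x, ((star a * a : SmoothFun d M) : M → ℂ) x ∂μ =
      ((∫ x, ‖(a : M → ℂ) x‖ ^ 2 ∂μ : ℝ) : ℂ) := by
    rw [← integral_complex_ofReal]
    refine integral_congr_ae (Eventually.of_forall fun x => ?_)
    simp [Complex.conj_mul']
  rw [h2] at h1
  exact (Complex.continuous_re.tendsto _).comp h1

/-- `Op(1)` approximates the identity only in the normalised Hilbert-Schmidt norm: the four traces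
in the expansion of `(1 - P)†(1 - P)` tend to `1 - 1 - 1 + 1`. -/
theorem tendsto_hsNorm_one_sub [CompactSpace M] [IsProbabilityMeasure μ]
    (φ : ∀ N : ℕ, OrthonormalBasis (Fin N) ℂ (EuclideanSpace ℂ (Fin N))) :
    Tendsto (fun N => hsNorm (φ N) (1 - Op N 1)) (atTopIn Idx) (𝓝 0) := by
  have h1 := hOp.trace 1
  have h2 := (hOp.conj 1).symm.tendsto_trace_sub.add h1
  have h3 := (hOp.conjTranspose_mul_self 1).tendsto_trace_sub.add (hOp.trace (star 1 * 1))
  rw [star_one] at h2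
  simp only [sub_add_cancel, star_one, mul_one] at h2 h3
  have h4 := ((tendsto_const_nhds (x := (1 : ℂ))).sub h1).sub (h2.sub h3)
  have h5 : Tendsto (fun N => ((hsNorm (φ N) (1 - Op N 1) ^ 2 : ℝ) : ℂ)) (atTopIn Idx) (𝓝 0) := by
    have : (1 : ℂ) - ∫ x, ((1 : SmoothFun d M) : M → ℂ) x ∂μ -
      (0 + ∫ x, ((1 : SmoothFun d M) : M → ℂ) x ∂μ - (0 + ∫ x, ((1 : SmoothFun d M) : M → ℂ) x ∂μ)) = 0 := by
      simp
    rw [this] at h4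
    refine h4.congr' ?_
    filter_upwards [eventually_ne_zero_atTopIn Idx] with N hN
    have hN' : (N : ℂ) ≠ 0 := by exact_mod_cast hN
    rw [hsNorm_sq, Matrix.conjTranspose_sub, Matrix.conjTranspose_one,
      show (1 - (Op N 1).conjTranspose) * (1 - Op N 1) =
        1 - Op N 1 - ((Op N 1).conjTranspose - (Op N 1).conjTranspose * Op N 1) by noncomm_ring]
    simp only [Matrix.trace_sub, mul_sub]
    simp [hN']
  have h6 := ((Complex.continuous_re.tendsto _).comp h5).sqrt
  simpa [Function.comp_def, Real.sqrt_sq (hsNorm_nonneg _ _), ← Complex.ofReal_pow] using h6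

end IsObservableQuantization

end Observables

/-! ### Null sets on a manifold -/

section Manifold

variable {d : ℕ} {M : Type*} [TopologicalSpace M] [ChartedSpace (EuclideanSpace ℝ (Fin d)) M]

theorem volume_closure_eq_zero {A : Set (EuclideanSpace ℝ (Fin d))}
    (h : upperMinkowskiContent (d : ℝ) A = 0) : volume (closure A) = 0 := by
  rw [← nonpos_iff_eq_zero, ← h, upperMinkowskiContent]
  calc volume (closure A) = limsup (fun _ : ℝ => volume (closure A)) (𝓝[>] (0 : ℝ)) :=
        limsup_const _ |>.symm
    _ ≤ _ := by
      refine limsup_le_limsup (Eventually.of_forall fun ε => ?_)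
      simp only [sub_self, Real.rpow_zero, ENNReal.ofReal_one, one_mul]
      exact measure_mono (Metric.closure_subset_cthickening ε A)

variable (d M) in
theorem exists_finset_forall_mem_chartAt_source [CompactSpace M] :
    ∃ t : Finset M, ∀ x : M, ∃ p ∈ t, x ∈ (chartAt (EuclideanSpace ℝ (Fin d)) p).source := by
  obtain ⟨t, ht⟩ := CompactSpace.elim_nhds_subcover
    (fun p : M => (chartAt (EuclideanSpace ℝ (Fin d)) p).source)
    (fun p => chart_source_mem_nhds _ p)
  refine ⟨t, fun x => ?_⟩
  have hx : x ∈ ⋃ p ∈ t, (chartAt (EuclideanSpace ℝ (Fin d)) p).source := ht ▸ Set.mem_univ x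
  simpa using hx

variable [MeasurableSpace M] {μ : Measure M}

/-- Closed neighbourhoods contain the closure, so Minkowski content zero makes even the closure a
Lebesgue null set in each chart; finitely many charts cover the manifold. -/
theorem measure_closure_eq_zero [CompactSpace M] (hμ : IsAbsContLebesgue d μ) {A : Set M}
    (h : HasMinkowskiContentZero d A) : μ (closure A) = 0 := by
  obtain ⟨t, ht⟩ := exists_finset_forall_mem_chartAt_source d M
  have hsub : closure A ⊆ ⋃ p ∈ t, (chartAt (EuclideanSpace ℝ (Fin d)) p).source ∩
      chartAt (EuclideanSpace ℝ (Fin d)) p ⁻¹'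
        closure (chartAt (EuclideanSpace ℝ (Fin d)) p ''
          (A ∩ (chartAt (EuclideanSpace ℝ (Fin d)) p).source)) := by
    intro x hx
    obtain ⟨p, hp, hxp⟩ := ht x
    simp only [Set.mem_iUnion]
    refine ⟨p, hp, hxp, ?_⟩
    have h1 : x ∈ closure (A ∩ (chartAt (EuclideanSpace ℝ (Fin d)) p).source) := by
      rw [Set.inter_comm]
      exact (chartAt (EuclideanSpace ℝ (Fin d)) p).open_source.inter_closure ⟨hxp, hx⟩
    exact mem_closure_image ((chartAt (EuclideanSpace ℝ (Fin d)) p).continuousAt hxp) h1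
  refine measure_mono_null hsub ?_
  exact (measure_biUnion_null_iff t.countable_toSet).2 fun p _ => hμ _ (chart_mem_atlas _ p) _
    (volume_closure_eq_zero (h _ (chart_mem_atlas _ p)))

variable [IsManifold (𝓡 d) ∞ M]

omit [MeasurableSpace M] in
theorem contDiffAt_in_charts {Φ : M → M} {p q x : M} (hΦ : ContMDiffAt (𝓡 d) (𝓡 d) ∞ Φ x)
    (hx : x ∈ (chartAt (EuclideanSpace ℝ (Fin d)) p).source)
    (hq : Φ x ∈ (chartAt (EuclideanSpace ℝ (Fin d)) q).source) :
    ContDiffAt ℝ ∞ (chartAt (EuclideanSpace ℝ (Fin d)) q ∘ Φ ∘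
      (chartAt (EuclideanSpace ℝ (Fin d)) p).symm) (chartAt (EuclideanSpace ℝ (Fin d)) p x) := by
  have := ((contMDiffAt_iff_of_mem_source hx hq).1 hΦ).2
  simpa [mfld_simps, contDiffWithinAt_univ] using this

/-- Sard's lemma in equal dimensions: the points near which a smooth map is not open have a null
image. -/
theorem measure_image_not_nhds_le_map [CompactSpace M] (hμ : IsAbsContLebesgue d μ) {Φ : M → M}
    {O : Set M} (hO : ∀ x ∈ O, ContMDiffAt (𝓡 d) (𝓡 d) ∞ Φ x) :
    μ (Φ '' {x | x ∈ O ∧ ¬ 𝓝 (Φ x) ≤ map Φ (𝓝 x)}) = 0 := by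
  obtain ⟨t, ht⟩ := exists_finset_forall_mem_chartAt_source d M
  let e : M → OpenPartialHomeomorph M (EuclideanSpace ℝ (Fin d)) := fun p => chartAt _ p
  let f : M → M → EuclideanSpace ℝ (Fin d) → EuclideanSpace ℝ (Fin d) :=
    fun p q => e q ∘ Φ ∘ (e p).symm
  let Z : M → M → Set (EuclideanSpace ℝ (Fin d)) := fun p q =>
    {z | ContDiffAt ℝ ∞ (f p q) z ∧ (fderiv ℝ (f p q) z).det = 0}
  have hsub : Φ '' {x | x ∈ O ∧ ¬ 𝓝 (Φ x) ≤ map Φ (𝓝 x)} ⊆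
      ⋃ p ∈ t, ⋃ q ∈ t, (e q).source ∩ e q ⁻¹' (f p q '' Z p q) := by
    rintro _ ⟨x, ⟨hxO, hx⟩, rfl⟩
    obtain ⟨p, hp, hxp⟩ := ht x
    obtain ⟨q, hq, hxq⟩ := ht (Φ x)
    have hf : ContDiffAt ℝ ∞ (f p q) (e p x) := contDiffAt_in_charts (hO x hxO) hxp hxq
    have hfx : f p q (e p x) = e q (Φ x) := by
      simp only [f, Function.comp_apply, (e p).left_inv hxp]
    simp only [Set.mem_iUnion]
    refine ⟨p, hp, q, hq, hxq, e p x, ⟨hf, ?_⟩, hfx⟩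
    -- A nonzero determinant would make the map open near `x`, by the inverse function theorem in
    -- charts; only critical values remain.
    by_contra hdet
    refine hx (le_of_eq ?_)
    have hs := hf.hasStrictFDerivAt (by simp)
    rw [← ContinuousLinearMap.coe_toContinuousLinearEquivOfDetNeZero _ hdet] at hs
    have h1 := hs.map_nhds_eq_of_equiv
    rw [hfx, ← (e p).map_nhds_eq hxp, map_map] at h1
    rw [← (e q).symm_map_nhds_eq hxq, ← h1, map_map]
    refine Filter.map_congr ?_
    filter_upwards [(e p).open_source.mem_nhds hxp,
      (hO x hxO).continuousAt.preimage_mem_nhds ((e q).open_source.mem_nhds hxq)] with y hy1 hy2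
    simp only [f, Function.comp_apply, (e p).left_inv hy1, (e q).left_inv hy2]
  refine measure_mono_null hsub ?_
  refine (measure_biUnion_null_iff t.countable_toSet).2 fun p _ =>
    (measure_biUnion_null_iff t.countable_toSet).2 fun q _ => hμ _ (chart_mem_atlas _ q) _ ?_
  exact addHaar_image_eq_zero_of_det_fderivWithin_eq_zero volume
    (fun z hz => (hz.1.differentiableAt (by simp)).hasFDerivAt.hasFDerivWithinAt) fun z hz => hz.2

end Manifold

/-! ### The domain of continuity -/

section Continuity

variable {d : ℕ} {M : Type*} [TopologicalSpace M] [ChartedSpace (EuclideanSpace ℝ (Fin d)) M]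
  {κ : Type*} {V : κ → Set M} {Φ : Equiv.Perm M}

theorem isClosed_discontinuityDomain : IsClosed (discontinuityDomain V) := isClosed_closure

theorem continuityDomain_one : continuityDomain V Φ 1 = (discontinuityDomain V)ᶜ := by
  ext x
  simp [continuityDomain]

theorem continuityDomain_succ (k : ℕ) :
    continuityDomain V Φ (k + 1) = (discontinuityDomain V)ᶜ ∩ Φ ⁻¹' continuityDomain V Φ k := by
  ext x
  simp only [continuityDomain, Set.mem_ofPred_eq, Set.mem_inter_iff, Set.mem_compl_iff,
    Set.mem_preimage]
  constructor
  · intro h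
    exact ⟨by simpa using h 0 (by omega), fun j hj => by simpa [pow_succ] using h (j + 1) (by omega)⟩
  · rintro ⟨h0, h⟩ j hj
    rcases j with _ | j
    · simpa using h0
    · simpa [pow_succ] using h j (by omega)

theorem continuityDomain_anti {k l : ℕ} (h : k ≤ l) :
    continuityDomain V Φ l ⊆ continuityDomain V Φ k := fun _ hx j hj => hx j (hj.trans_le h)

namespace IsPiecewiseSmooth

variable (hΦ : IsPiecewiseSmooth d V Φ)
include hΦ

/-- The connected component `W` of `x` off the discontinuities is open, hence meets some `V i` by
density. No frontier point of `V i` lies in `W`, so `V i` is clopen relative to `W` and contains it.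
-/
theorem exists_mem_of_notMem_discontinuityDomain {x : M} (hx : x ∉ discontinuityDomain V) :
    ∃ i, x ∈ V i := by
  have := ChartedSpace.locallyConnectedSpace (EuclideanSpace ℝ (Fin d)) M
  set W := connectedComponentIn (discontinuityDomain V)ᶜ x with hW
  have hWo : IsOpen W := isClosed_discontinuityDomain.isOpen_compl.connectedComponentIn
  have hxW : x ∈ W := mem_connectedComponentIn hx
  have hd : Dense (⋃ i, V i) := dense_iff_closure_eq.2 hΦ.dense
  obtain ⟨y, hyW, hy⟩ := hd.inter_open_nonempty W hWo ⟨x, hxW⟩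
  obtain ⟨i, hi⟩ := Set.mem_iUnion.1 hy
  refine ⟨i, isPreconnected_connectedComponentIn.subset_of_closure_inter_subset (hΦ.isOpen i)
    ⟨y, hyW, hi⟩ ?_ hxW⟩
  rintro z ⟨hz, hzW⟩
  by_contra hzi
  refine connectedComponentIn_subset _ _ hzW (subset_closure (Set.mem_iUnion.2 ⟨i, hz, ?_⟩))
  rwa [(hΦ.isOpen i).interior_eq]

theorem contMDiffAt {x : M} (hx : x ∉ discontinuityDomain V) :
    ContMDiffAt (𝓡 d) (𝓡 d) ∞ Φ x := by
  obtain ⟨i, hi⟩ := hΦ.exists_mem_of_notMem_discontinuityDomain hx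
  obtain ⟨Ψ, hΨ, heq⟩ := hΦ.smooth i
  have hV := (hΦ.isOpen i).mem_nhds hi
  exact (hΨ.contMDiffAt (mem_of_superset hV subset_closure)).congr_of_eventuallyEq
    (heq.eventuallyEq_of_mem hV).symm

theorem isOpen_continuityDomain (k : ℕ) : IsOpen (continuityDomain V Φ k) := by
  induction k with
  | zero => simp [continuityDomain]
  | succ k ih =>
    rw [continuityDomain_succ]
    exact ContinuousOn.isOpen_inter_preimage
      (fun x hx => (hΦ.contMDiffAt hx).continuousAt.continuousWithinAt)
      isClosed_discontinuityDomain.isOpen_compl ih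

variable [CompactSpace M] [MeasurableSpace M] {μ : Measure M}

theorem measure_discontinuityDomain (hμ : IsAbsContLebesgue d μ) :
    μ (discontinuityDomain V) = 0 :=
  measure_mono_null subset_closure (measure_closure_eq_zero hμ hΦ.content)

theorem measure_compl_continuityDomain (hμ : IsAbsContLebesgue d μ)
    (hΦμ : MeasurePreserving Φ μ μ) (k : ℕ) : μ (continuityDomain V Φ k)ᶜ = 0 := by
  induction k with
  | zero => simp [continuityDomain]
  | succ k ih =>
    rw [continuityDomain_succ, Set.compl_inter, compl_compl]
    exact measure_union_null (hΦ.measure_discontinuityDomain hμ)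
      (hΦμ.quasiMeasurePreserving.preimage_null ih)

end IsPiecewiseSmooth

end Continuity

/-! ### Pullback of test functions -/

section Pullback

/-- Measurability of the inverse is the Lusin–Souslin theorem: an injective measurable map on a
standard Borel space is a measurable embedding. Second countability and metrizability of the compact
manifold supply the standard Borel structure. -/
theorem measurePreserving_symm_of_manifold (d : ℕ) {M : Type*} [TopologicalSpace M] [T2Space M]
    [CompactSpace M] [ChartedSpace (EuclideanSpace ℝ (Fin d)) M] [MeasurableSpace M] [BorelSpace M]
    {μ : Measure M} {Φ : Equiv.Perm M} (hΦμ : MeasurePreserving Φ μ μ) :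
    MeasurePreserving Φ.symm μ μ := by
  have := ChartedSpace.secondCountable_of_sigmaCompact (EuclideanSpace ℝ (Fin d)) M
  have := Manifold.metrizableSpace (𝓡 d) M
  let _ := TopologicalSpace.metrizableSpaceMetric M
  have h : MeasurableEmbedding Φ := hΦμ.measurable.measurableEmbedding Φ.injective
  let Φ' : M ≃ᵐ M := ⟨Φ, hΦμ.measurable, fun s hs => by
    rw [← Equiv.image_eq_preimage_symm]; exact h.measurableSet_image' hs⟩
  exact MeasurePreserving.symm Φ' hΦμ

variable {d : ℕ} {M : Type*} [TopologicalSpace M] [T2Space M] [CompactSpace M]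
  [ChartedSpace (EuclideanSpace ℝ (Fin d)) M] [MeasurableSpace M] [BorelSpace M] {μ : Measure M}
  [IsManifold (𝓡 d) ∞ M] {κ : Type*} {V : κ → Set M} {Φ : Equiv.Perm M}

/-- `Φ` need not be a local diffeomorphism, so the support of `a ∘ Φ` could reach the
discontinuities. `G` consists of the points of `O` near which everything is hit from a compact `L ⊆
O`; injectivity of `Φ` then confines the support of `a ∘ Φ` to a compact subset of `O`. Sard's lemma
and invariance of the measure make the complement of `G` null. -/
theorem exists_isOpen_forall_pullback (hμ : IsAbsContLebesgue d μ) (hΦ : IsPiecewiseSmooth d V Φ)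
    (hΦμ : MeasurePreserving Φ μ μ) {O : Set M} (hO : IsOpen O) (hO0 : μ Oᶜ = 0)
    (hOV : O ⊆ (discontinuityDomain V)ᶜ) :
    ∃ G : Set M, IsOpen G ∧ μ Gᶜ = 0 ∧ G ⊆ O ∧ ∀ a : SmoothFun d M, tsupport (a : M → ℂ) ⊆ G →
      ∃ b : SmoothFun d M, (b : M → ℂ) = (a : M → ℂ) ∘ Φ ∧ tsupport (b : M → ℂ) ⊆ O := by
  have hlc := ChartedSpace.locallyCompactSpace (EuclideanSpace ℝ (Fin d)) M
  refine ⟨O ∩ {y | ∃ L, IsCompact L ∧ L ⊆ O ∧ Φ '' L ∈ 𝓝 y}, ?_, ?_, Set.inter_subset_left, ?_⟩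
  · refine hO.inter (isOpen_iff_mem_nhds.2 ?_)
    rintro y ⟨L, hL, hLO, hy⟩
    filter_upwards [eventually_mem_nhds_iff.2 hy] with z hz using ⟨L, hL, hLO, hz⟩
  · have hsub : (O ∩ {y | ∃ L, IsCompact L ∧ L ⊆ O ∧ Φ '' L ∈ 𝓝 y})ᶜ ⊆
        Oᶜ ∪ (Φ.symm ⁻¹' Oᶜ ∪ Φ '' {x | x ∈ O ∧ ¬ 𝓝 (Φ x) ≤ map Φ (𝓝 x)}) := by
      intro y hy
      by_contra hcon
      simp only [Set.mem_union, Set.mem_compl_iff, Set.mem_preimage, Set.mem_image,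
        Set.mem_ofPred_eq, not_or, not_not, not_exists, not_and] at hcon
      obtain ⟨hyO, hxO, hcon⟩ := hcon
      have h1 : 𝓝 y ≤ map Φ (𝓝 (Φ.symm y)) := by
        by_contra h
        exact hcon _ ⟨hxO, by simpa using h⟩ (by simp)
      obtain ⟨L, hLx, hLO, hL⟩ := local_compact_nhds (hO.mem_nhds hxO)
      exact hy ⟨hyO, L, hL, hLO, h1 (image_mem_map hLx)⟩
    refine measure_mono_null hsub (measure_union_null hO0 (measure_union_null ?_ ?_))
    · exact (measurePreserving_symm_of_manifold d hΦμ).quasiMeasurePreserving.preimage_null hO0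
    · exact measure_image_not_nhds_le_map hμ fun x hx => hΦ.contMDiffAt (hOV hx)
  · intro a ha
    have hK : IsCompact (tsupport (a : M → ℂ)) := (isClosed_tsupport _).isCompact
    obtain ⟨L, hL, hLO, hKL⟩ : ∃ L, IsCompact L ∧ L ⊆ O ∧ tsupport (a : M → ℂ) ⊆ Φ '' L := by
      refine hK.induction_on (p := fun K => ∃ L, IsCompact L ∧ L ⊆ O ∧ K ⊆ Φ '' L)
        ⟨∅, isCompact_empty, Set.empty_subset _, Set.empty_subset _⟩
        (fun K K' h ⟨L, hL, hLO, hK⟩ => ⟨L, hL, hLO, h.trans hK⟩)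
        (fun K K' ⟨L, hL, hLO, hK⟩ ⟨L', hL', hLO', hK'⟩ => ⟨L ∪ L', hL.union hL',
          Set.union_subset hLO hLO', by rw [Set.image_union]; exact Set.union_subset_union hK hK'⟩)
        fun y hy => ?_
      obtain ⟨L, hL, hLO, hy⟩ := (ha hy).2
      exact ⟨Φ '' L, mem_nhdsWithin_of_mem_nhds hy, L, hL, hLO, subset_rfl⟩
    have hsupp : tsupport ((a : M → ℂ) ∘ Φ) ⊆ L := by
      refine closure_minimal (fun x hx => ?_) hL.isClosed
      obtain ⟨z, hz, hzx⟩ := hKL (subset_tsupport _ hx)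
      exact Φ.injective hzx ▸ hz
    refine ⟨⟨(a : M → ℂ) ∘ Φ, ?_⟩, rfl, hsupp.trans hLO⟩
    exact contMDiff_of_tsupport fun x hx =>
      (SmoothFun.contMDiff a (Φ x)).comp x (hΦ.contMDiffAt (hOV (hLO (hsupp hx))))

/-- Egorov's property for the iterates of `Φ`, for observables supported in an open set of full
measure. -/
theorem exists_isOpen_forall_pullback_pow (hμ : IsAbsContLebesgue d μ)
    (hΦ : IsPiecewiseSmooth d V Φ) (hΦμ : MeasurePreserving Φ μ μ) {Idx : Set ℕ}
    {Op : ∀ N : ℕ, SmoothFun d M →ₗ[ℂ] Matrix (Fin N) (Fin N) ℂ}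
    {U : ∀ N : ℕ, Matrix.unitaryGroup (Fin N) ℂ} (hU : IsMapQuantization d V Φ Idx Op U) (m : ℕ)
    {O : Set M} (hO : IsOpen O) (hO0 : μ Oᶜ = 0) (hOV : O ⊆ (discontinuityDomain V)ᶜ) :
    ∃ G : Set M, IsOpen G ∧ μ Gᶜ = 0 ∧ ∀ a : SmoothFun d M, tsupport (a : M → ℂ) ⊆ G →
      ∃ b : SmoothFun d M, (b : M → ℂ) = (a : M → ℂ) ∘ ⇑(Φ ^ m) ∧ tsupport (b : M → ℂ) ⊆ O ∧
        SemiclassicallyEquivalent Idx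
          (fun N => Op N a * (U N : Matrix (Fin N) (Fin N) ℂ) ^ m)
          (fun N => (U N : Matrix (Fin N) (Fin N) ℂ) ^ m * Op N b) := by
  induction m generalizing O with
  | zero =>
    refine ⟨O, hO, hO0, fun a ha => ⟨a, by simp, ha, ?_⟩⟩
    simp [SemiclassicallyEquivalent, tendsto_const_nhds]
  | succ m ih =>
    -- The domains are built backwards: `a ∘ Φ ^ m` must land in `G₁`, from which one further
    -- pullback lands in `O`. Both supports then avoid the discontinuities, as the quantization
    -- axiom requires.
    obtain ⟨G₁, hG₁, hG₁0, hG₁O, h₁⟩ := exists_isOpen_forall_pullback hμ hΦ hΦμ hO hO0 hOV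
    obtain ⟨G, hG, hG0, h⟩ := ih hG₁ hG₁0 (hG₁O.trans hOV)
    refine ⟨G, hG, hG0, fun a ha => ?_⟩
    obtain ⟨b, hb, hbG, hab⟩ := h a ha
    obtain ⟨c, hc, hcO⟩ := h₁ b hbG
    refine ⟨c, by rw [hc, hb, pow_succ]; rfl, hcO, ?_⟩
    have h2 : SemiclassicallyEquivalent Idx
        (fun N => Op N b * (U N : Matrix (Fin N) (Fin N) ℂ))
        (fun N => (U N : Matrix (Fin N) (Fin N) ℂ) * Op N c) := by
      have := (hU b c hc (by rw [continuityDomain_one]; exact hbG.trans (hG₁O.trans hOV))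
        (by rw [continuityDomain_one]; exact hcO.trans hOV)).mul_left
          (by simpa using isBoundedSequence_unitaryGroup_pow Idx U 1)
      simpa only [← mul_assoc, ← Submonoid.coe_mul, mul_inv_cancel, Submonoid.coe_one,
        one_mul] using this
    have h3 := hab.mul_right (by simpa using isBoundedSequence_unitaryGroup_pow Idx U 1)
    have h4 := h2.mul_left (isBoundedSequence_unitaryGroup_pow Idx U m)
    simp only [pow_succ, ← mul_assoc] at h3 h4 ⊢
    exact h3.trans h4

end Pullback

/-! ### Approximation by smooth functions and annihilators -/

section Approximation

variable {d : ℕ} {M : Type*} [TopologicalSpace M] [T2Space M] [CompactSpace M]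
  [ChartedSpace (EuclideanSpace ℝ (Fin d)) M] [MeasurableSpace M] [BorelSpace M] {μ : Measure M}

/-- The `L²` norm of a function. -/
def l2Norm (μ : Measure M) (f : M → ℂ) : ℝ := (eLpNorm f 2 μ).toReal

omit [TopologicalSpace M] [T2Space M] [CompactSpace M] [BorelSpace M]
  [ChartedSpace (EuclideanSpace ℝ (Fin d)) M] in
theorem l2Norm_eq_sqrt {f : M → ℂ} (hf : MemLp f 2 μ) :
    l2Norm μ f = √(∫ x, ‖f x‖ ^ 2 ∂μ) := by
  rw [l2Norm, hf.eLpNorm_eq_integral_rpow_norm two_ne_zero ENNReal.ofNat_ne_top,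
    ENNReal.toReal_ofReal (by positivity), Real.sqrt_eq_rpow]
  simp

omit [T2Space M] in
theorem SmoothFun.memLp [IsFiniteMeasure μ] (a : SmoothFun d M) (p : ENNReal) :
    MemLp (a : M → ℂ) p μ := by
  obtain ⟨c, -, hc⟩ := SmoothFun.exists_norm_lt a
  exact MemLp.of_bound (SmoothFun.continuous a).aestronglyMeasurable c
    (Eventually.of_forall fun x => (hc x).le)

omit [T2Space M] in
theorem SmoothFun.memLp_mul {h : M → ℂ} {p : ENNReal} (hh : MemLp h p μ) (a : SmoothFun d M) :
    MemLp (fun x => (a : M → ℂ) x * h x) p μ := by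
  obtain ⟨c, -, hc⟩ := SmoothFun.exists_norm_lt a
  exact hh.of_le_mul ((SmoothFun.continuous a).aestronglyMeasurable.mul hh.1)
    (Eventually.of_forall fun x => by rw [norm_mul]; gcongr; exact (hc x).le)

omit [T2Space M] in
/-- If all functions annihilating the null space of a limit of seminorms annihilate `f`, then the
limit seminorm is bounded by the `L²` distance to `f`. -/
theorem eventually_seminorm_le_of_annihilator [IsFiniteMeasure μ] {l : Filter ℕ}
    (r : ℕ → Seminorm ℂ (SmoothFun d M))
    (hr : ∀ a : SmoothFun d M, ∀ ε > 0, ∀ᶠ N in l, r N a ≤ l2Norm μ (a : M → ℂ) + ε)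
    {f : M → ℂ} (hf : MemLp f 2 μ)
    (hann : ∀ h : M → ℂ, MemLp h 2 μ → (∀ a : SmoothFun d M, Tendsto (fun N => r N a) l (𝓝 0) →
      ∫ x, (a : M → ℂ) x * h x ∂μ = 0) → ∫ x, f x * h x ∂μ = 0)
    (a : SmoothFun d M) {ε : ℝ} (hε : 0 < ε) :
    ∀ᶠ N in l, r N a ≤ l2Norm μ (fun x => (a : M → ℂ) x - f x) + ε := by
  let Z : Submodule ℂ (SmoothFun d M) :=
    { carrier := {a | Tendsto (fun N => r N a) l (𝓝 0)}
      zero_mem' := by simp [tendsto_const_nhds]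
      add_mem' := fun {a b} ha hb => squeeze_zero (fun N => apply_nonneg _ _)
        (fun N => map_add_le_add (r N) a b) (by simpa using Tendsto.add ha hb)
      smul_mem' := fun c a ha => by
        simpa [map_smul_eq_mul] using Tendsto.const_mul ‖c‖ ha }
  let ι : SmoothFun d M →ₗ[ℂ] Lp ℂ 2 μ :=
    { toFun := fun a => (SmoothFun.memLp a 2).toLp _
      map_add' := fun a b => MemLp.toLp_add _ _
      map_smul' := fun c a => MemLp.toLp_const_smul _ _ }
  have hmem : hf.toLp f ∈ (Z.map ι).topologicalClosure := by
    rw [← Submodule.orthogonal_orthogonal_eq_closure, Submodule.mem_orthogonal]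
    intro g hg
    rw [L2.inner_def]
    -- Conjugating `g` turns the sesquilinear inner product into the bilinear pairing of `hann`.
    have hgm : MemLp (fun x => (starRingEnd ℂ) (g x)) 2 μ := (Lp.memLp g).star
    have := hann _ hgm fun b hb => by
      have h1 := (Submodule.mem_orthogonal' _ _).1 hg (ι b) (Submodule.mem_map_of_mem hb)
      rw [L2.inner_def] at h1
      rw [← h1]
      refine integral_congr_ae ?_
      filter_upwards [(SmoothFun.memLp (μ := μ) b 2).coeFn_toLp] with x hx
      simp [ι, hx]
    rw [← this]
    refine integral_congr_ae ?_
    filter_upwards [hf.coeFn_toLp] with x hx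
    simp [hx]
  obtain ⟨_, ⟨b, hb, rfl⟩, hab⟩ := Metric.mem_closure_iff.1 hmem (ε / 3) (by positivity)
  have h1 : l2Norm μ ((a - b : SmoothFun d M) : M → ℂ) ≤
      l2Norm μ (fun x => (a : M → ℂ) x - f x) + ε / 3 := by
    have h2 : l2Norm μ ((a - b : SmoothFun d M) : M → ℂ) = dist (ι a) (ι b) := by
      rw [dist_eq_norm, ← map_sub]; exact (Lp.norm_toLp _ (SmoothFun.memLp (a - b) 2)).symm
    have h3 : l2Norm μ (fun x => (a : M → ℂ) x - f x) = dist (ι a) (hf.toLp f) := by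
      rw [dist_eq_norm]
      exact (Lp.norm_toLp _ ((SmoothFun.memLp a 2).sub hf)).symm
    rw [h2, h3]
    exact (dist_triangle _ (hf.toLp f) _).trans (by gcongr)
  filter_upwards [hr (a - b) (ε / 3) (by positivity),
    hb.eventually (gt_mem_nhds (show 0 < ε / 3 by positivity))] with N hN hbN
  have h4 := map_add_le_add (r N) (a - b) b
  rw [sub_add_cancel] at h4
  linarith

variable [IsManifold (𝓡 d) ∞ M]

theorem ae_eq_zero_of_annihilator {h : M → ℂ} (hh : MemLp h 2 μ) [IsFiniteMeasure μ] {O : Set M}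
    (hO : IsOpen O) (hann : ∀ a : SmoothFun d M, tsupport (a : M → ℂ) ⊆ O →
      ∫ x, (a : M → ℂ) x * h x ∂μ = 0) : ∀ᵐ x ∂μ, x ∈ O → h x = 0 := by
  refine hO.ae_eq_zero_of_integral_contMDiff_smul_eq_zero (𝓡 d)
    ((hh.integrable (by norm_num)).integrableOn.locallyIntegrableOn) fun g hg _ hgO => ?_
  let a : SmoothFun d M := ⟨fun x => (g x : ℂ), fun x =>
    (Complex.ofRealCLM.contDiff (n := ∞)).contMDiff.comp hg x⟩
  have ha : tsupport (a : M → ℂ) = tsupport g := by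
    simp [tsupport, Function.support, a]
  simpa [a, Complex.real_smul] using hann a (ha ▸ hgO)

omit [T2Space M] [MeasurableSpace M] [BorelSpace M] [IsManifold (𝓡 d) ∞ M] in
/-- Every set of smooth functions is separable in the supremum norm. -/
theorem SmoothFun.exists_countable_dense (T : Set (SmoothFun d M)) :
    ∃ T' ⊆ T, T'.Countable ∧ ∀ a ∈ T, ∀ ε > 0, ∃ b ∈ T', ∀ x,
      ‖(a : M → ℂ) x - (b : M → ℂ) x‖ < ε := by
  have := ChartedSpace.secondCountable_of_sigmaCompact (EuclideanSpace ℝ (Fin d)) M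
  have := ChartedSpace.locallyCompactSpace (EuclideanSpace ℝ (Fin d)) M
  let F : SmoothFun d M → C(M, ℂ) := fun a => ⟨a, SmoothFun.continuous a⟩
  obtain ⟨s, hs, hsd⟩ := TopologicalSpace.exists_countable_dense (F '' T)
  choose g hgT hgF using fun u : F '' T => u.2
  refine ⟨g '' s, by rintro _ ⟨u, -, rfl⟩; exact hgT u, hs.image _, fun a ha ε hε => ?_⟩
  obtain ⟨u, hu, hus⟩ := Metric.dense_iff.1 hsd ⟨F a, a, ha, rfl⟩ ε hε
  refine ⟨g u, ⟨u, hus, rfl⟩, fun x => ?_⟩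
  have h1 : dist (F a) (F (g u)) < ε := by rw [hgF, dist_comm]; exact hu
  exact (dist_eq_norm (F a x) (F (g u) x)).symm.trans_lt
    ((ContinuousMap.dist_apply_le_dist x).trans_lt h1)

omit [MeasurableSpace M] [BorelSpace M] in
theorem SmoothFun.exists_bump {x : M} {O : Set M} (hO : IsOpen O) (hx : x ∈ O) :
    ∃ a : SmoothFun d M, tsupport (a : M → ℂ) ⊆ O ∧ (a : M → ℂ) x = 1 := by
  obtain ⟨f, hf0, hf1, -⟩ := exists_contMDiffMap_zero_one_nhds_of_isClosed (𝓡 d) (n := ⊤)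
    hO.isClosed_compl isClosed_singleton (Set.disjoint_singleton_right.2 (fun h => h hx))
  refine ⟨⟨fun x => (f x : ℂ), fun x =>
    (Complex.ofRealCLM.contDiff (n := ∞)).contMDiff.comp f.contMDiff x⟩, ?_, ?_⟩
  · intro y hy
    by_contra hyO
    have h1 := hf0.filter_mono (nhds_le_nhdsSet hyO)
    refine notMem_tsupport_iff_eventuallyEq.2 ?_ hy
    filter_upwards [h1] with z hz
    simp [hz]
  · simp [hf1.self_of_nhdsSet x rfl]

/-- A function annihilating all `g · (a ∘ Ψ - a)` vanishes off the fixed points of `Ψ`. -/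
theorem ae_eq_zero_or_fixed_of_annihilator [IsFiniteMeasure μ] {h : M → ℂ} (hh : MemLp h 2 μ)
    {G : Set M} (hG : IsOpen G) (hG0 : μ Gᶜ = 0) {Ψ : M → M}
    (hann : ∀ a : SmoothFun d M, tsupport (a : M → ℂ) ⊆ G → ∃ b : SmoothFun d M,
      (b : M → ℂ) = (a : M → ℂ) ∘ Ψ ∧ ∀ g : SmoothFun d M,
        ∫ x, ((g * (b - a) : SmoothFun d M) : M → ℂ) x * h x ∂μ = 0) :
    ∀ᵐ x ∂μ, Ψ x = x ∨ h x = 0 := by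
  -- A countable dense family lets one null set serve all test functions.
  obtain ⟨T, hTG, hT, hdense⟩ := SmoothFun.exists_countable_dense
    {a : SmoothFun d M | tsupport (a : M → ℂ) ⊆ G}
  have h1 : ∀ a ∈ T, ∀ᵐ x ∂μ, ((a : M → ℂ) (Ψ x) - (a : M → ℂ) x) * h x = 0 := by
    intro a ha
    obtain ⟨b, hb, hbg⟩ := hann a (hTG ha)
    have h2 := ae_eq_zero_of_annihilator (SmoothFun.memLp_mul hh (b - a)) isOpen_univ fun g _ => by
      rw [← hbg g]
      exact integral_congr_ae (Eventually.of_forall fun x => (mul_assoc _ _ _).symm)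
    filter_upwards [h2] with x hx
    simpa [hb] using hx (Set.mem_univ x)
  filter_upwards [(ae_ball_iff hT).2 h1, show ∀ᵐ x ∂μ, x ∈ G from hG0] with x hx hxG
  by_contra! hcon
  -- If `Ψ x ≠ x` and `h x ≠ 0`, take `a` with `a x = 1` and `a (Ψ x) = 0`. A member `b` of the
  -- family within `1/2` of `a` has `b (Ψ x) = b x`, which would be less than `1/2` away from both 0
  -- and 1.
  obtain ⟨a, haG, hax⟩ := SmoothFun.exists_bump (d := d) (hG.inter isOpen_compl_singleton)
    (show x ∈ G ∩ {Ψ x}ᶜ from ⟨hxG, fun h => hcon.1 h.symm⟩)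
  obtain ⟨b, hb, hab⟩ := hdense a (haG.trans Set.inter_subset_left) (1 / 2) (by norm_num)
  have hb1 : (b : M → ℂ) (Ψ x) = (b : M → ℂ) x :=
    sub_eq_zero.1 ((mul_eq_zero.1 (hx b hb)).resolve_right hcon.2)
  have ha0 : (a : M → ℂ) (Ψ x) = 0 := image_eq_zero_of_notMem_tsupport fun h => (haG h).2 rfl
  have h3 := hab x
  have h4 := hab (Ψ x)
  rw [ha0, zero_sub, norm_neg, hb1] at h4
  rw [hax] at h3
  have h5 := norm_add_le ((1 : ℂ) - (b : M → ℂ) x) ((b : M → ℂ) x)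
  rw [sub_add_cancel, norm_one] at h5
  linarith

/-- A function annihilating all `a - a ∘ Φ` is invariant. -/
theorem ae_eq_comp_of_annihilator [IsFiniteMeasure μ] {h : M → ℂ} (hh : MemLp h 2 μ)
    {G : Set M} (hG : IsOpen G) (hG0 : μ Gᶜ = 0) {Φ : Equiv.Perm M}
    (hΦμ : MeasurePreserving Φ μ μ)
    (hann : ∀ a : SmoothFun d M, tsupport (a : M → ℂ) ⊆ G → ∃ b : SmoothFun d M,
      (b : M → ℂ) = (a : M → ℂ) ∘ Φ ∧
        ∫ x, ((b - a : SmoothFun d M) : M → ℂ) x * h x ∂μ = 0) :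
    h ∘ Φ =ᵐ[μ] h := by
  have hs := measurePreserving_symm_of_manifold d hΦμ
  have hhs : MemLp (h ∘ Φ.symm) 2 μ := hh.comp_measurePreserving hs
  have h1 := ae_eq_zero_of_annihilator (hhs.sub hh) hG fun a ha => by
    obtain ⟨b, hb, hbh⟩ := hann a ha
    have hint : ∀ (c : SmoothFun d M) {k : M → ℂ}, MemLp k 2 μ →
        Integrable (fun x => (c : M → ℂ) x * k x) μ := fun c k hk =>
      (SmoothFun.memLp_mul hk c).integrable (by norm_num)
    have h2 : ∫ x, (b : M → ℂ) x * h x ∂μ = ∫ x, (a : M → ℂ) x * (h ∘ Φ.symm) x ∂μ := by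
      conv_lhs => rw [← hs.map_eq]
      rw [integral_map hs.measurable.aemeasurable (by rw [hs.map_eq]; exact (hint b hh).1)]
      simp [hb]
    calc ∫ x, (a : M → ℂ) x * (h ∘ Φ.symm - h) x ∂μ
        = ∫ x, ((a : M → ℂ) x * (h ∘ Φ.symm) x - (a : M → ℂ) x * h x) ∂μ := by
          simp [mul_sub]
      _ = ∫ x, ((b : M → ℂ) x * h x - (a : M → ℂ) x * h x) ∂μ := by
          rw [integral_sub (hint a hhs) (hint a hh), integral_sub (hint b hh) (hint a hh), h2]
      _ = 0 := by rw [← hbh]; simp [sub_mul]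
  have h3 : h ∘ Φ.symm =ᵐ[μ] h := by
    filter_upwards [h1, show ∀ᵐ x ∂μ, x ∈ G from hG0] with x hx hxG using sub_eq_zero.1 (hx hxG)
  have h4 := hΦμ.quasiMeasurePreserving.ae_eq_comp h3
  simpa [Function.comp_def] using h4.symm

/-- Smooth functions between `0` and `1` approximating the indicator of a set together with
their squares. -/
theorem SmoothFun.exists_approx_indicator [IsFiniteMeasure μ] {D : Set M}
    (hD : NullMeasurableSet D μ) {ε : ℝ} (hε : 0 < ε) :
    ∃ χ : SmoothFun d M, (∀ x, ‖(χ : M → ℂ) x‖ ≤ 1) ∧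
      l2Norm μ (fun x => (χ : M → ℂ) x - D.indicator 1 x) ≤ ε ∧
      l2Norm μ (fun x => ((star χ * χ : SmoothFun d M) : M → ℂ) x - D.indicator 1 x) ≤ ε := by
  have := ChartedSpace.secondCountable_of_sigmaCompact (EuclideanSpace ℝ (Fin d)) M
  have := Manifold.metrizableSpace (𝓡 d) M
  have hε2 : ENNReal.ofReal (ε ^ 2) / 2 ≠ 0 := by
    simpa using hε.ne'
  obtain ⟨D', hDD', hD'm, hD'⟩ := hD.exists_measurable_superset_ae_eq
  obtain ⟨O, hDO, hO, hOμ⟩ := D'.exists_isOpen_lt_add (measure_ne_top μ _) hε2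
  obtain ⟨D'', hD''D, hD''m, hD''⟩ := hD.exists_measurable_subset_ae_eq
  obtain ⟨K, hKD, hK, hKμ⟩ := hD''m.exists_isCompact_lt_add (measure_ne_top μ _) hε2
  have hKO : K ⊆ O := hKD.trans (hD''D.trans (hDD'.trans hDO))
  have hdiff : μ (O \ K) ≤ ENNReal.ofReal (ε ^ 2) := by
    rw [measure_sdiff hKO hK.measurableSet.nullMeasurableSet (measure_ne_top _ _), tsub_le_iff_left]
    calc μ O ≤ μ D' + ENNReal.ofReal (ε ^ 2) / 2 := hOμ.le
      _ = μ D'' + ENNReal.ofReal (ε ^ 2) / 2 := by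
        rw [measure_congr hD', measure_congr hD'']
      _ ≤ μ K + ENNReal.ofReal (ε ^ 2) / 2 + ENNReal.ofReal (ε ^ 2) / 2 := by gcongr
      _ = _ := by rw [add_assoc, ENNReal.add_halves]
  obtain ⟨f, hf0, hf1, hf⟩ := exists_contMDiffMap_zero_one_of_isClosed (𝓡 d) (n := ⊤)
    hO.isClosed_compl hK.isClosed (Set.disjoint_compl_left_iff_subset.2 hKO)
  -- The error lives on `O \ K`, of measure at most `ε²`, and is bounded by 1 there; the estimate
  -- covers both the bump function and its square.
  have hest : ∀ g : M → ℂ, (∀ x ∉ O, g x = 0) → (∀ x ∈ K, g x = 1) →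
      (∀ x, ∃ t : ℝ, g x = t ∧ 0 ≤ t ∧ t ≤ 1) →
      l2Norm μ (fun x => g x - D.indicator 1 x) ≤ ε := by
    intro g hg0 hg1 hg
    have h1 : eLpNorm (fun x => g x - D.indicator 1 x) 2 μ ≤
        eLpNorm ((O \ K).indicator fun _ => (1 : ℝ)) 2 μ := by
      refine eLpNorm_mono fun x => ?_
      by_cases hxK : x ∈ K
      · have hxD : x ∈ D := hD''D (hKD hxK)
        simp [hg1 x hxK, hxD]
      by_cases hxO : x ∈ O
      · obtain ⟨t, ht, ht0, ht1⟩ := hg x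
        rw [Set.indicator_of_mem (show x ∈ O \ K from ⟨hxO, hxK⟩), norm_one, ht]
        by_cases hxD : x ∈ D
        · rw [Set.indicator_of_mem hxD, Pi.one_apply, ← Complex.ofReal_one, ← Complex.ofReal_sub,
            Complex.norm_real, Real.norm_eq_abs, abs_le]
          constructor <;> linarith
        · rw [Set.indicator_of_notMem hxD, sub_zero, Complex.norm_real, Real.norm_eq_abs, abs_le]
          constructor <;> linarith
      · have hxD : x ∉ D := fun h => hxO (hDO (hDD' h))
        simp [hg0 x hxO, hxD]
    rw [eLpNorm_indicator_const (hO.measurableSet.diff hK.measurableSet) two_ne_zero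
      ENNReal.ofNat_ne_top] at h1
    refine ENNReal.toReal_le_of_le_ofReal hε.le (h1.trans ?_)
    simp only [enorm_one, one_mul, ENNReal.toReal_ofNat]
    calc μ (O \ K) ^ (1 / 2 : ℝ) ≤ ENNReal.ofReal (ε ^ 2) ^ (1 / 2 : ℝ) := by gcongr
      _ = ENNReal.ofReal ε := by
        rw [ENNReal.ofReal_rpow_of_nonneg (by positivity) (by norm_num), ← Real.sqrt_eq_rpow,
          Real.sqrt_sq hε.le]
  refine ⟨⟨fun x => (f x : ℂ), fun x =>
    (Complex.ofRealCLM.contDiff (n := ∞)).contMDiff.comp f.contMDiff x⟩, fun x => ?_,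
    hest _ (fun x hx => ?_) (fun x hx => ?_) (fun x => ⟨f x, rfl, hf x⟩),
    hest _ (fun x hx => ?_) (fun x hx => ?_) (fun x => ⟨f x * f x, by simp, ?_⟩)⟩
  · simpa using abs_le.2 ⟨by linarith [(hf x).1], (hf x).2⟩
  · simpa using hf0 hx
  · simpa using hf1 hx
  · simpa using hf0 hx
  · simp [hf1 hx]
  · exact ⟨mul_self_nonneg _, mul_le_one₀ (hf x).2 (hf x).1 (hf x).2⟩

end Approximation

/-! ### The `L²` norm -/

section L2Norm

variable {M : Type*} [MeasurableSpace M] {μ : Measure M}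

theorem l2Norm_add_le {f g : M → ℂ} (hf : MemLp f 2 μ) (hg : MemLp g 2 μ) :
    l2Norm μ (fun x => f x + g x) ≤ l2Norm μ f + l2Norm μ g := by
  rw [l2Norm, l2Norm, l2Norm, ← ENNReal.toReal_add hf.eLpNorm_ne_top hg.eLpNorm_ne_top]
  exact ENNReal.toReal_mono (by finiteness [hf.eLpNorm_ne_top, hg.eLpNorm_ne_top])
    (eLpNorm_add_le hf.1 hg.1 (by norm_num))

theorem memLp_indicator_of_nullMeasurableSet [IsFiniteMeasure μ] {E : Set M} (hE : NullMeasurableSet E μ)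
    {f : M → ℂ} (hf : MemLp f 2 μ) : MemLp (E.indicator f) 2 μ := by
  obtain ⟨E', -, hE'm, hE'⟩ := hE.exists_measurable_superset_ae_eq
  exact (memLp_congr_ae (indicator_ae_eq_of_ae_eq_set hE')).1 (hf.indicator hE'm)

theorem l2Norm_indicator_le [IsFiniteMeasure μ] {E : Set M} (hE : NullMeasurableSet E μ)
    {f : M → ℂ} {c : ℝ} (hc : 0 ≤ c) (hf : ∀ x, ‖f x‖ ≤ c) :
    l2Norm μ (E.indicator f) ≤ c * √(μ.real E) := by
  have h1 : eLpNorm (E.indicator f) 2 μ ≤ eLpNorm (E.indicator fun _ => c) 2 μ := by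
    refine eLpNorm_mono fun x => ?_
    by_cases hx : x ∈ E
    · simpa [hx] using (hf x).trans (le_abs_self c)
    · simp [hx]
  rw [eLpNorm_indicator_const₀ hE two_ne_zero ENNReal.ofNat_ne_top] at h1
  have h2 := ENNReal.toReal_mono (by finiteness) h1
  rw [ENNReal.toReal_mul, ← ENNReal.toReal_rpow] at h2
  simpa [l2Norm, Real.sqrt_eq_rpow, Measure.real, abs_of_nonneg hc] using h2

end L2Norm

/-! ### Fixed matrix size -/

section Fixed

variable {N : ℕ}

/-- This supplies the `L²` domination that the duality principle requires of the trace seminorms. -/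
theorem norm_normalised_trace_pow_mul_le (φ : OrthonormalBasis (Fin N) ℂ (EuclideanSpace ℂ (Fin N)))
    (U : Matrix.unitaryGroup (Fin N) ℂ) (m : ℕ) (A : Matrix (Fin N) (Fin N) ℂ) :
    ‖(1 / (N : ℂ)) * ((U : Matrix (Fin N) (Fin N) ℂ) ^ m * A).trace‖ ≤ hsNorm φ A := by
  rw [trace_eq_sum_expectation φ, norm_mul, norm_div, norm_one, Complex.norm_natCast, one_div_mul_eq_div]
  have h1 : ‖∑ j, expectation φ ((U : Matrix (Fin N) (Fin N) ℂ) ^ m * A) j‖ ≤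
      ∑ j, ‖Matrix.toEuclideanCLM (𝕜 := ℂ) A (φ j)‖ := by
    refine norm_sum_le_of_le _ fun j _ => (norm_expectation_le _ _ _).trans ?_
    rw [map_mul, mul_apply_eq_comp]
    refine (ContinuousLinearMap.le_opNorm _ _).trans ?_
    rw [← Matrix.cstar_norm_def]
    exact mul_le_of_le_one_left (norm_nonneg _) (norm_unitaryGroup_pow_le U m)
  refine (div_le_div_of_nonneg_right h1 (by positivity)).trans ((sum_norm_div_le _ _).trans ?_)
  refine mul_le_of_le_one_left (hsNorm_nonneg _ _) (Real.sqrt_le_one.2 ?_)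
  simpa using div_self_le_one (N : ℝ)

/-- After rotating `w` to 1, the Fejér kernel is at least `(K / 2)²` on the selected arc. The
diagonal of the expanded square costs at most `K C`, the rest at most `K² e`; division by `(K / 2)²`
gives the bound. -/
theorem sum_filter_div_le_of_power_sums {q : Fin N → ℝ} (hq : ∀ j, 0 ≤ q j) {z : Fin N → ℂ}
    (hz : ∀ j, ‖z j‖ = 1) {w : ℂ} (hw : ‖w‖ = 1) {K : ℕ} (hK : 0 < K) {C e : ℝ} (he0 : 0 ≤ e)
    (hC : (∑ j, q j) / N ≤ C)
    (he : ∀ m, 1 ≤ m → m < K → ‖∑ j, (q j : ℂ) * z j ^ m‖ / N ≤ e) :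
    (∑ j with ‖z j - w‖ * (2 * K) ≤ 1, q j) / N ≤ 4 * C / K + 4 * e := by
  have hww : w * (starRingEnd ℂ) w = 1 := by
    rw [Complex.mul_conj, Complex.normSq_eq_norm_sq, hw]; simp
  let y : Fin N → ℂ := fun j => z j * (starRingEnd ℂ) w
  have hy : ∀ j, ‖y j‖ = 1 := fun j => by simp [y, hz, hw]
  have hy1 : ∀ j, ‖y j - 1‖ = ‖z j - w‖ := fun j => by
    rw [← hww, ← sub_mul, norm_mul, Complex.norm_conj, hw, mul_one]
  have hypow : ∀ m, ‖∑ j, (q j : ℂ) * y j ^ m‖ = ‖∑ j, (q j : ℂ) * z j ^ m‖ := fun m => by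
    simp_rw [y, mul_pow, ← mul_assoc, ← Finset.sum_mul]
    simp [hw]
  have hKr : (0 : ℝ) < K := by exact_mod_cast hK
  have h1 : (∑ j with ‖z j - w‖ * (2 * K) ≤ 1, q j) * (K / 2) ^ 2 ≤
      ∑ j, q j * ‖∑ k ∈ Finset.range K, y j ^ k‖ ^ 2 := by
    rw [Finset.sum_mul]
    refine (Finset.sum_le_sum fun j hj => ?_).trans
      (Finset.sum_le_sum_of_subset_of_nonneg (Finset.filter_subset _ _) fun j _ _ =>
        mul_nonneg (hq j) (sq_nonneg _))
    have := half_le_norm_sum_pow (hy j) (K := K) (by rw [hy1]; exact (Finset.mem_filter.1 hj).2)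
    have := hq j
    gcongr
  have h2 := sum_mul_norm_sum_pow_sq_le q hy K
  have hterm : ∀ k ∈ Finset.range K, ∀ l ∈ Finset.range K,
      ‖∑ j, (q j : ℂ) * y j ^ ((k - l) + (l - k))‖ / N ≤ (if k = l then C else 0) + e := by
    intro k hk l hl
    rw [hypow]
    have hk := Finset.mem_range.1 hk
    have hl := Finset.mem_range.1 hl
    split_ifs with h
    · subst h
      have : ‖∑ j, (q j : ℂ)‖ = ∑ j, q j := by
        rw [← Complex.ofReal_sum, Complex.norm_real, Real.norm_of_nonneg]
        exact Finset.sum_nonneg fun j _ => hq j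
      simp only [tsub_self, add_zero, pow_zero, mul_one, this]
      linarith
    · rw [zero_add]
      exact he _ (by omega) (by omega)
  have h3 : (∑ k ∈ Finset.range K, ∑ l ∈ Finset.range K,
      ‖∑ j, (q j : ℂ) * y j ^ ((k - l) + (l - k))‖) / N ≤ K * C + K * (K * e) := by
    rw [Finset.sum_div]
    simp_rw [Finset.sum_div]
    refine (Finset.sum_le_sum fun k hk => Finset.sum_le_sum fun l hl => hterm k hk l hl).trans ?_
    simp only [Finset.sum_add_distrib, Finset.sum_ite_eq, Finset.sum_const, Finset.card_range,
      nsmul_eq_mul, Finset.sum_ite_mem, Finset.inter_self]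
    exact le_rfl
  have h4 : (∑ j with ‖z j - w‖ * (2 * K) ≤ 1, q j) / N * (K / 2) ^ 2 ≤
      K * C + K * (K * e) := by
    rw [div_mul_eq_mul_div]
    exact (div_le_div_of_nonneg_right (h1.trans h2) (by positivity)).trans h3
  have h5 : 4 * C / K + 4 * e = (K * C + K * (K * e)) / (K / 2) ^ 2 := by
    field_simp
    ring
  rwa [h5, le_div_iff₀ (by positivity)]

end Fixed

/-! ### Traces of the iterates -/

section Trace

variable {d : ℕ} {M : Type*} [TopologicalSpace M] [T2Space M] [CompactSpace M]
  [ChartedSpace (EuclideanSpace ℝ (Fin d)) M] [MeasurableSpace M] [BorelSpace M]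
  {μ : Measure M} [IsFiniteMeasure μ]
  {κ : Type*} {V : κ → Set M} {Φ : Equiv.Perm M} {Idx : Set ℕ}
  {Op : ∀ N : ℕ, SmoothFun d M →ₗ[ℂ] Matrix (Fin N) (Fin N) ℂ}
  {U : ∀ N : ℕ, Matrix.unitaryGroup (Fin N) ℂ}

omit [T2Space M] in
theorem IsObservableQuantization.eventually_hsNorm_le (hOp : IsObservableQuantization d μ Idx Op)
    (φ : ∀ N : ℕ, OrthonormalBasis (Fin N) ℂ (EuclideanSpace ℂ (Fin N)))
    (a : SmoothFun d M) {ε : ℝ} (hε : 0 < ε) :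
    ∀ᶠ N in atTopIn Idx, hsNorm (φ N) (Op N a) ≤ l2Norm μ (a : M → ℂ) + ε := by
  have h1 := (hOp.tendsto_hsNorm_sq a φ).sqrt
  rw [← l2Norm_eq_sqrt (SmoothFun.memLp a 2)] at h1
  simp_rw [Real.sqrt_sq (hsNorm_nonneg _ _)] at h1
  filter_upwards [h1.eventually (gt_mem_nhds (lt_add_of_pos_right _ hε))] with N hN using hN.le

variable [IsManifold (𝓡 d) ∞ M]

/-- The trace asymptotics for the iterates of the quantum map: off the set `D₀` of non-periodic
points, `N⁻¹ tr (U ^ m Op(a))` is asymptotically bounded by the `L²` norm. -/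
theorem eventually_norm_trace_pow_mul_le (hμ : IsAbsContLebesgue d μ)
    (hΦ : IsPiecewiseSmooth d V Φ) (hΦμ : MeasurePreserving Φ μ μ)
    (hOp : IsObservableQuantization d μ Idx Op) (hU : IsMapQuantization d V Φ Idx Op U)
    {D₀ : Set M} (hD₀ : NullMeasurableSet D₀ μ) {m : ℕ} (hfix : μ {x | x ∈ D₀ ∧ (Φ ^ m) x = x} = 0)
    (a : SmoothFun d M) {ε : ℝ} (hε : 0 < ε) :
    ∀ᶠ N : ℕ in atTopIn Idx, ‖(1 / (N : ℂ)) * ((U N : Matrix (Fin N) (Fin N) ℂ) ^ m * Op N a).trace‖ ≤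
      l2Norm μ (fun x => (a : M → ℂ) x - D₀.indicator 1 x) + ε := by
  let T : ∀ N : ℕ, SmoothFun d M →ₗ[ℂ] ℂ := fun N => (1 / (N : ℂ)) •
    (Matrix.traceLinearMap (Fin N) ℂ ℂ ∘ₗ
      LinearMap.mulLeft ℂ ((U N : Matrix (Fin N) (Fin N) ℂ) ^ m) ∘ₗ Op N)
  let r : ℕ → Seminorm ℂ (SmoothFun d M) := fun N => (normSeminorm ℂ ℂ).comp (T N)
  have hT : ∀ N a, T N a =
      (1 / (N : ℂ)) * ((U N : Matrix (Fin N) (Fin N) ℂ) ^ m * Op N a).trace := fun N a => rfl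
  let φ : ∀ N : ℕ, OrthonormalBasis (Fin N) ℂ (EuclideanSpace ℂ (Fin N)) := fun N =>
    EuclideanSpace.basisFun (Fin N) ℂ
  refine eventually_seminorm_le_of_annihilator r (fun a ε hε => ?_)
    (memLp_indicator_of_nullMeasurableSet hD₀ (memLp_const (1 : ℂ))) (fun h hh hann => ?_) a hε
  · filter_upwards [hOp.eventually_hsNorm_le φ a hε] with N hN
    exact (norm_normalised_trace_pow_mul_le (φ N) _ _ _).trans hN
  obtain ⟨G, hG, hG0, hpull⟩ := exists_isOpen_forall_pullback_pow hμ hΦ hΦμ hU m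
    isClosed_discontinuityDomain.isOpen_compl
    (by rw [compl_compl]; exact hΦ.measure_discontinuityDomain hμ) subset_rfl
  -- With `b = a ∘ Φ ^ m`, cyclicity and Egorov give `tr(U ^ m Op(g) Op(a)) = tr(Op(a) U ^ m Op(g))
  -- ≈ tr(U ^ m Op(b) Op(g))` after normalisation. Hence `g · (b - a)` is null for every `g`.
  have key := ae_eq_zero_or_fixed_of_annihilator (Ψ := ⇑(Φ ^ m)) hh hG hG0 fun a ha => by
    obtain ⟨b, hb, -, hab⟩ := hpull a ha
    refine ⟨b, hb, fun g => hann _ ?_⟩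
    have hUm := isBoundedSequence_unitaryGroup_pow Idx U m
    have h1 := ((hOp.mul b g).mul_left hUm).tendsto_trace_sub
    have h2 := (hab.mul_right (hOp.isBoundedSequence g)).tendsto_trace_sub
    have h3 := ((hOp.mul g a).mul_left hUm).tendsto_trace_sub
    have h4 := ((h3.sub h1).sub h2).norm
    simp only [sub_zero, norm_zero] at h4
    refine h4.congr fun N => ?_
    change _ = ‖T N (g * (b - a))‖
    rw [mul_sub, map_sub, hT, hT, mul_comm g b]
    have h5 : ((U N : Matrix (Fin N) (Fin N) ℂ) ^ m * (Op N g * Op N a)).trace =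
        (Op N a * (U N : Matrix (Fin N) (Fin N) ℂ) ^ m * Op N g).trace := by
      rw [← mul_assoc, Matrix.trace_mul_comm, mul_assoc]
    rw [h5, mul_assoc _ (Op N b)]
    congr 1
    ring
  have h0 : ∀ᵐ x ∂μ, ¬ (x ∈ D₀ ∧ (Φ ^ m) x = x) := by
    rw [ae_iff]; simpa using hfix
  rw [integral_eq_zero_of_ae]
  filter_upwards [key, h0] with x hx hx0
  by_cases hxD : x ∈ D₀
  · simp [hx.resolve_left fun h => hx0 ⟨hxD, h⟩]
  · simp [hxD]

end Trace

theorem sum_biUnion_le_of_nonneg {ι α : Type*} [DecidableEq α] (F : Finset ι) (s : ι → Finset α)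
    {q : α → ℝ} (hq : ∀ a, 0 ≤ q a) : ∑ a ∈ F.biUnion s, q a ≤ ∑ i ∈ F, ∑ a ∈ s i, q a := by
  classical
  induction F using Finset.induction_on with
  | empty => simp
  | insert i F hi ih =>
    rw [Finset.biUnion_insert, Finset.sum_insert hi]
    have h1 := Finset.sum_union_inter (s₁ := s i) (s₂ := F.biUnion s) (f := q)
    have h2 : 0 ≤ ∑ a ∈ s i ∩ F.biUnion s, q a := Finset.sum_nonneg fun a _ => hq a
    linarith

/-! ### Counting eigenvalues near finitely many roots of unity -/

section Counting

variable {d : ℕ} {M : Type*} [TopologicalSpace M] [T2Space M] [CompactSpace M]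
  [ChartedSpace (EuclideanSpace ℝ (Fin d)) M] [MeasurableSpace M] [BorelSpace M]
  {μ : Measure M} [IsProbabilityMeasure μ] {Idx : Set ℕ}
  {Op : ∀ N : ℕ, SmoothFun d M →ₗ[ℂ] Matrix (Fin N) (Fin N) ℂ}
  {U : ∀ N : ℕ, Matrix.unitaryGroup (Fin N) ℂ}
  {φ : ∀ N : ℕ, OrthonormalBasis (Fin N) ℂ (EuclideanSpace ℂ (Fin N))}
  {lam : ∀ N : ℕ, Fin N → ℂ}

omit [T2Space M] [BorelSpace M] in
/-- If the traces of `U ^ m Op(|χ|²)` are small for `m ≥ 1`, then `Op(χ)` is small on average on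
the eigenvectors with eigenvalues near an `n`-th root of `w`. -/
theorem eventually_sum_filter_div_le (hOp : IsObservableQuantization d μ Idx Op)
    (hlam : ∀ N j, ‖lam N j‖ = 1)
    (hUφ : ∀ N ∈ Idx, ∀ j : Fin N, Matrix.toEuclideanCLM (𝕜 := ℂ)
      (U N : Matrix (Fin N) (Fin N) ℂ) (φ N j) = lam N j • φ N j)
    (χ : SmoothFun d M) (hχ : ∀ x, ‖(χ : M → ℂ) x‖ ≤ 1) {e : ℝ} (he : 0 < e)
    (htr : ∀ m, 1 ≤ m → ∀ᶠ N : ℕ in atTopIn Idx,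
      ‖(1 / (N : ℂ)) * ((U N : Matrix (Fin N) (Fin N) ℂ) ^ m * Op N (star χ * χ)).trace‖ ≤ e)
    {n : ℕ} (hn : 1 ≤ n) {w : ℂ} (hw : ‖w‖ = 1) {K : ℕ} (hK : 0 < K) :
    ∀ᶠ N : ℕ in atTopIn Idx,
      (∑ j with ‖lam N j ^ n - w‖ * (2 * K) ≤ 1,
        ‖Matrix.toEuclideanCLM (𝕜 := ℂ) (Op N χ) (φ N j)‖ ^ 2) / N ≤ 8 / K + 8 * e := by
  have hX : ∀ m, 1 ≤ m → ∀ᶠ N : ℕ in atTopIn Idx, ‖(1 / (N : ℂ)) *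
      ((U N : Matrix (Fin N) (Fin N) ℂ) ^ m * ((Op N χ).conjTranspose * Op N χ)).trace‖ ≤
      2 * e := by
    intro m hm
    have h1 := ((hOp.conjTranspose_mul_self χ).mul_left
      (isBoundedSequence_unitaryGroup_pow Idx U m)).tendsto_trace_sub.norm
    rw [norm_zero] at h1
    filter_upwards [h1.eventually (gt_mem_nhds he), htr m hm] with N h2 h3
    have h4 := norm_sub_norm_le ((1 / (N : ℂ)) *
      ((U N : Matrix (Fin N) (Fin N) ℂ) ^ m * ((Op N χ).conjTranspose * Op N χ)).trace)
      ((1 / (N : ℂ)) * ((U N : Matrix (Fin N) (Fin N) ℂ) ^ m * Op N (star χ * χ)).trace)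
    linarith
  have hC : ∀ᶠ N : ℕ in atTopIn Idx, hsNorm (φ N) (Op N χ) ^ 2 < 2 := by
    refine (hOp.tendsto_hsNorm_sq χ φ).eventually (gt_mem_nhds (lt_of_le_of_lt ?_ one_lt_two))
    calc ∫ x, ‖(χ : M → ℂ) x‖ ^ 2 ∂μ ≤ ∫ _, (1 : ℝ) ∂μ :=
          integral_mono_of_nonneg (Eventually.of_forall fun _ => by positivity)
            (integrable_const _) (Eventually.of_forall fun x => pow_le_one₀ (norm_nonneg _) (hχ x))
      _ = 1 := by simp
  -- The `m`-th power sum of `λ ^ n` is the trace with `U ^ (n * m)`. Only finitely many exponents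
  -- occur once `K` is fixed.
  have hall : ∀ᶠ N : ℕ in atTopIn Idx, ∀ m ∈ Finset.Ico 1 K, ‖(1 / (N : ℂ)) *
      ((U N : Matrix (Fin N) (Fin N) ℂ) ^ (n * m) *
        ((Op N χ).conjTranspose * Op N χ)).trace‖ ≤ 2 * e :=
    (eventually_all_finset _).2 fun m hm =>
      hX _ (Nat.mul_pos hn (Finset.mem_Ico.1 hm).1)
  filter_upwards [hC, hall, eventually_mem_atTopIn Idx] with N hC hall hN
  refine (sum_filter_div_le_of_power_sums (C := 2) (e := 2 * e)
    (fun j => sq_nonneg _) (z := fun j => lam N j ^ n) (fun j => by simp [hlam]) hw hK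
    (by positivity) ?_ ?_).trans
    (le_of_eq (by ring))
  · rw [hsNorm, rootMeanSquare, Real.sq_sqrt (by positivity)] at hC
    exact hC.le
  · intro m hm hmK
    refine le_trans (le_of_eq ?_) (hall m (Finset.mem_Ico.2 ⟨hm, hmK⟩))
    rw [trace_eq_sum_expectation (φ N), norm_mul, norm_div, norm_one, Complex.norm_natCast,
      one_div_mul_eq_div]
    congr 2
    refine Finset.sum_congr rfl fun j _ => ?_
    rw [expectation_pow_mul (hlam N) (hUφ N hN), expectation_conjTranspose_mul_self, pow_mul,
      mul_comm]

variable [IsManifold (𝓡 d) ∞ M] {κ : Type*} {V : κ → Set M} {Φ : Equiv.Perm M}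

/-- The proportion of eigenvalues near finitely many periodic phases is asymptotically at most the
measure of the periodic part. -/
theorem exists_eventually_card_filter_div_le (hμ : IsAbsContLebesgue d μ)
    (hΦ : IsPiecewiseSmooth d V Φ) (hΦμ : MeasurePreserving Φ μ μ)
    (hOp : IsObservableQuantization d μ Idx Op) (hU : IsMapQuantization d V Φ Idx Op U)
    {D₀ : Set M} (hD₀ : NullMeasurableSet D₀ μ)
    (hfix : ∀ m, 1 ≤ m → μ {x | x ∈ D₀ ∧ (Φ ^ m) x = x} = 0)
    (hlam : ∀ N j, ‖lam N j‖ = 1)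
    (hUφ : ∀ N ∈ Idx, ∀ j : Fin N, Matrix.toEuclideanCLM (𝕜 := ℂ)
      (U N : Matrix (Fin N) (Fin N) ℂ) (φ N j) = lam N j • φ N j)
    {ι : Type*} (F : Finset ι) {n : ι → ℕ} (hn : ∀ ν, 1 ≤ n ν) {w : ι → ℂ} (hw : ∀ ν, ‖w ν‖ = 1)
    {ε : ℝ} (hε : 0 < ε) :
    ∃ η > 0, ∀ᶠ N : ℕ in atTopIn Idx,
      ((Finset.univ.filter fun j => ∃ ν ∈ F, ‖lam N j ^ n ν - w ν‖ < η).card : ℝ) / N ≤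
        1 - μ.real D₀ + ε := by
  classical
  obtain ⟨t, ht0, ht1, htε⟩ : ∃ t : ℝ, 0 < t ∧ t ≤ 1 ∧ 3 * t ≤ ε :=
    ⟨min 1 (ε / 3), by positivity, min_le_left _ _, by linarith [min_le_right 1 (ε / 3)]⟩
  obtain ⟨e, he, het, heF⟩ : ∃ e : ℝ, 0 < e ∧ e ≤ t / 8 ∧ F.card * (32 * e) ≤ (t / 4) ^ 2 := by
    refine ⟨min (t / 8) ((t / 4) ^ 2 / ((F.card + 1) * 32)), by positivity, min_le_left _ _, ?_⟩
    have h1 := min_le_right (t / 8) ((t / 4) ^ 2 / ((F.card + 1) * 32))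
    rw [le_div_iff₀ (by positivity)] at h1
    have : 0 < min (t / 8) ((t / 4) ^ 2 / ((F.card + 1) * 32)) := by positivity
    nlinarith
  obtain ⟨K, hKe⟩ := exists_nat_gt (1 / e)
  have hK : (0 : ℝ) < K := (by positivity : 0 < 1 / e).trans hKe
  have hK8 : 8 / (K : ℝ) ≤ 8 * e := by
    rw [div_le_iff₀ hK]
    rw [div_lt_iff₀ he] at hKe
    linarith
  obtain ⟨χ, hχ1, hχ, hχ2⟩ := SmoothFun.exists_approx_indicator (d := d) hD₀ he
  have h1χ : l2Norm μ ((1 - χ : SmoothFun d M) : M → ℂ) ≤ √(1 - μ.real D₀) + t / 8 := by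
    have h1 : ((1 - χ : SmoothFun d M) : M → ℂ) =
        fun x => D₀ᶜ.indicator (fun _ => (1 : ℂ)) x + (D₀.indicator 1 x - (χ : M → ℂ) x) := by
      ext x
      by_cases hx : x ∈ D₀ <;> simp [hx, sub_eq_add_neg]
    have hm := memLp_indicator_of_nullMeasurableSet (f := fun _ => (1 : ℂ)) hD₀.compl
      (memLp_const (μ := μ) (1 : ℂ))
    have hm' := memLp_indicator_of_nullMeasurableSet (f := fun _ => (1 : ℂ)) hD₀
      (memLp_const (μ := μ) (1 : ℂ))
    rw [h1]
    refine (l2Norm_add_le hm (hm'.sub (SmoothFun.memLp χ 2))).trans ?_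
    have h2 := l2Norm_indicator_le (f := fun _ => (1 : ℂ)) hD₀.compl zero_le_one (by simp)
    rw [one_mul, probReal_compl_eq_one_sub₀ hD₀] at h2
    have h3 : l2Norm μ (fun x => D₀.indicator 1 x - (χ : M → ℂ) x) ≤ t / 8 := by
      refine le_trans (le_of_eq ?_) (hχ.trans het)
      rw [l2Norm, l2Norm]
      exact congrArg _ (eLpNorm_sub_comm _ _ _ _)
    exact add_le_add h2 h3
  have hη : (0 : ℝ) < 1 / (2 * K) := by positivity
  refine ⟨1 / (2 * K), hη, ?_⟩
  have hν : ∀ᶠ N : ℕ in atTopIn Idx, ∀ ν ∈ F,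
      (∑ j with ‖lam N j ^ n ν - w ν‖ * (2 * K) ≤ 1,
        ‖Matrix.toEuclideanCLM (𝕜 := ℂ) (Op N χ) (φ N j)‖ ^ 2) / N ≤ 32 * e := by
    refine (eventually_all_finset _).2 fun ν _ => ?_
    -- The traces are at most `2 e`: one `e` from approximating the indicator by `|χ|²`, one from
    -- the limit. Altogether `8 / K + 16 e ≤ 24 e`.
    have h1 := eventually_sum_filter_div_le (φ := φ) hOp hlam hUφ χ hχ1 (e := 2 * e) (by positivity)
      (fun m hm => ?_) (hn ν) (hw ν) (by exact_mod_cast hK)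
    · filter_upwards [h1] with N hN
      linarith
    · filter_upwards [eventually_norm_trace_pow_mul_le hμ hΦ hΦμ hOp hU hD₀ (hfix m hm)
        (star χ * χ) he] with N hN
      linarith
  filter_upwards [hν, hOp.eventually_hsNorm_le φ (1 - χ) (show 0 < t / 8 by positivity),
    (hOp.tendsto_hsNorm_one_sub φ).eventually (gt_mem_nhds (show 0 < t / 4 by positivity)),
    eventually_ne_zero_atTopIn Idx] with N hν h2 h3 hN0
  set B := Finset.univ.filter fun j => ∃ ν ∈ F, ‖lam N j ^ n ν - w ν‖ < 1 / (2 * K) with hB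
  set β : ℝ := (B.card : ℝ) / N with hβ
  have h4 : rootMeanSquare B (fun j => Matrix.toEuclideanCLM (𝕜 := ℂ) (Op N χ) (φ N j)) ≤ t / 4 := by
    refine Real.sqrt_le_iff.2 ⟨by positivity, ?_⟩
    refine le_trans ?_ heF
    have hsub : B ⊆ F.biUnion fun ν =>
        Finset.univ.filter fun j => ‖lam N j ^ n ν - w ν‖ * (2 * K) ≤ 1 := by
      intro j hj
      obtain ⟨ν, hν, hj⟩ := (Finset.mem_filter.1 hj).2
      rw [lt_div_iff₀ (by positivity)] at hj
      exact Finset.mem_biUnion.2 ⟨ν, hν, Finset.mem_filter.2 ⟨Finset.mem_univ _, hj.le⟩⟩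
    calc _ ≤ (∑ ν ∈ F, ∑ j with ‖lam N j ^ n ν - w ν‖ * (2 * K) ≤ 1,
          ‖Matrix.toEuclideanCLM (𝕜 := ℂ) (Op N χ) (φ N j)‖ ^ 2) / N := by
          gcongr
          exact (Finset.sum_le_sum_of_subset_of_nonneg hsub fun _ _ _ => sq_nonneg _).trans
            (sum_biUnion_le_of_nonneg F _ fun _ => sq_nonneg _)
      _ ≤ ∑ ν ∈ F, 32 * e := by
          rw [Finset.sum_div]
          exact Finset.sum_le_sum hν
      _ = _ := by simp
  -- Split the identity as `(1 - Op(1)) + Op(1 - χ) + Op(χ)`. On `B` the outer terms have small mean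
  -- square, and the middle one has root mean square about `√(1 - μ(D₀))` at most. Cauchy–Schwarz
  -- over `B` supplies `√β`, and cancelling it yields the count.
  have h5 : β ≤ √β * (√(1 - μ.real D₀) + t) := by
    have hexp : ∀ j, (1 : ℝ) ≤ ‖expectation (φ N) (1 - Op N 1) j‖ +
        ‖expectation (φ N) (Op N (1 - χ)) j‖ +
        ‖Matrix.toEuclideanCLM (𝕜 := ℂ) (Op N χ) (φ N j)‖ := by
      intro j
      have h6 : expectation (φ N) (1 - Op N 1) j + expectation (φ N) (Op N (1 - χ)) j +
          expectation (φ N) (Op N χ) j = 1 := by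
        rw [← expectation_add, ← expectation_add, map_sub, add_assoc, sub_add_cancel,
          sub_add_cancel, expectation_one]
      calc (1 : ℝ) = ‖expectation (φ N) (1 - Op N 1) j + expectation (φ N) (Op N (1 - χ)) j +
          expectation (φ N) (Op N χ) j‖ := by rw [h6, norm_one]
        _ ≤ _ := norm_add₃_le
        _ ≤ _ := by gcongr; exact norm_expectation_le _ _ _
    have h7 : β ≤ (∑ j ∈ B, ‖expectation (φ N) (1 - Op N 1) j‖) / N +
        (∑ j ∈ B, ‖expectation (φ N) (Op N (1 - χ)) j‖) / N +
        (∑ j ∈ B, ‖Matrix.toEuclideanCLM (𝕜 := ℂ) (Op N χ) (φ N j)‖) / N := by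
      rw [← add_div, ← add_div, ← Finset.sum_add_distrib, ← Finset.sum_add_distrib, hβ]
      gcongr
      simpa using Finset.sum_le_sum fun j (_ : j ∈ B) => hexp j
    have h8 := sum_norm_div_le B (expectation (φ N) (1 - Op N 1))
    have h9 := sum_norm_div_le B (expectation (φ N) (Op N (1 - χ)))
    have h10 := sum_norm_div_le B fun j => Matrix.toEuclideanCLM (𝕜 := ℂ) (Op N χ) (φ N j)
    have h11 : rootMeanSquare B (expectation (φ N) (1 - Op N 1)) ≤ t / 4 :=
      (rootMeanSquare_expectation_le _ _ _).trans h3.le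
    have h12 : rootMeanSquare B (expectation (φ N) (Op N (1 - χ))) ≤
        √(1 - μ.real D₀) + t / 8 + t / 8 :=
      (rootMeanSquare_expectation_le _ _ _).trans (h2.trans (by gcongr))
    have h13 := mul_le_mul_of_nonneg_left h11 (Real.sqrt_nonneg β)
    have h14 := mul_le_mul_of_nonneg_left h12 (Real.sqrt_nonneg β)
    have h15 := mul_le_mul_of_nonneg_left h4 (Real.sqrt_nonneg β)
    have h16 := mul_nonneg (Real.sqrt_nonneg β) ht0.le
    linarith
  have hβ0 : 0 ≤ β := by positivity
  have hD1 : μ.real D₀ ≤ 1 := measureReal_le_one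
  have hδ : √(1 - μ.real D₀) ≤ 1 := Real.sqrt_le_one.2 (by linarith [measureReal_nonneg (μ := μ) (s := D₀)])
  have h6 : √β ≤ √(1 - μ.real D₀) + t := by
    rcases eq_or_lt_of_le (Real.sqrt_nonneg β) with h | h
    · rw [← h]; positivity
    · refine le_of_mul_le_mul_left ?_ h
      rwa [Real.mul_self_sqrt hβ0]
  calc β = √β ^ 2 := (Real.sq_sqrt hβ0).symm
    _ ≤ (√(1 - μ.real D₀) + t) ^ 2 := by gcongr
    _ = (1 - μ.real D₀) + t * (2 * √(1 - μ.real D₀) + t) := by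
      rw [add_sq, Real.sq_sqrt (by linarith)]; ring
    _ ≤ (1 - μ.real D₀) + t * 3 := by gcongr; linarith
    _ ≤ _ := by linarith

end Counting

/-! ### Quantum variance on eigenvectors away from the periodic phases -/

section Variance

/-- The root mean square of the expectation values over `J`, as a seminorm. -/
def expectationSeminorm {N : ℕ} {𝒜 : Type*} [AddCommGroup 𝒜] [Module ℂ 𝒜]
    (φ : OrthonormalBasis (Fin N) ℂ (EuclideanSpace ℂ (Fin N))) (J : Finset (Fin N))
    (Op : 𝒜 →ₗ[ℂ] Matrix (Fin N) (Fin N) ℂ) : Seminorm ℂ 𝒜 :=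
  Seminorm.of (fun a => rootMeanSquare J (expectation φ (Op a)))
    (fun a b => by
      simp only [map_add]
      refine le_trans (le_of_eq ?_) (rootMeanSquare_add_le J _ _)
      congr 1
      ext j
      exact expectation_add φ _ _ j)
    (fun c a => by
      rw [← rootMeanSquare_smul]
      congr 1
      ext j
      rw [map_smul]
      exact expectation_smul φ c _ j)

variable {d : ℕ} {M : Type*} [TopologicalSpace M] [T2Space M] [CompactSpace M]
  [ChartedSpace (EuclideanSpace ℝ (Fin d)) M] [MeasurableSpace M] [BorelSpace M]
  {μ : Measure M} [IsProbabilityMeasure μ] {Idx : Set ℕ}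
  {Op : ∀ N : ℕ, SmoothFun d M →ₗ[ℂ] Matrix (Fin N) (Fin N) ℂ}
  {U : ∀ N : ℕ, Matrix.unitaryGroup (Fin N) ℂ}
  {φ : ∀ N : ℕ, OrthonormalBasis (Fin N) ℂ (EuclideanSpace ℂ (Fin N))}
  {lam : ∀ N : ℕ, Fin N → ℂ}

/-- The expectation of `A U - U B` in an eigenvector is the eigenvalue times the difference of the
expectations, so Egorov's property makes expectations invariant under the map. -/
theorem norm_expectation_le_of_norm_eq_one {N : ℕ}
    (φ : OrthonormalBasis (Fin N) ℂ (EuclideanSpace ℂ (Fin N)))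
    {U : Matrix.unitaryGroup (Fin N) ℂ} {lam : Fin N → ℂ} (hlam : ∀ j, ‖lam j‖ = 1)
    (hU : ∀ j, Matrix.toEuclideanCLM (𝕜 := ℂ) (U : Matrix (Fin N) (Fin N) ℂ) (φ j) = lam j • φ j)
    (A B : Matrix (Fin N) (Fin N) ℂ) (j : Fin N) :
    ‖expectation φ (B - A) j‖ ≤ ‖A * (U : Matrix (Fin N) (Fin N) ℂ) ^ 1 -
      (U : Matrix (Fin N) (Fin N) ℂ) ^ 1 * B‖ := by
  have h1 : expectation φ (A * (U : Matrix (Fin N) (Fin N) ℂ) ^ 1) j = lam j * expectation φ A j := by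
    rw [expectation, map_mul, mul_apply_eq_comp, toEuclideanCLM_pow_apply hU, pow_one, map_smul,
      inner_smul_right, expectation]
  have h2 := norm_expectation_le_norm φ (A * (U : Matrix (Fin N) (Fin N) ℂ) ^ 1 -
      (U : Matrix (Fin N) (Fin N) ℂ) ^ 1 * B) j
  rw [expectation_sub, h1, expectation_pow_mul hlam hU, pow_one, ← mul_sub, norm_mul, hlam,
    one_mul, norm_sub_rev] at h2
  rwa [expectation_sub]

variable [IsManifold (𝓡 d) ∞ M] {κ : Type*} {V : κ → Set M} {Φ : Equiv.Perm M}
  {ι : Type*} {D : ι → Set M} {n : ι → ℕ} {α : ι → ℝ}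

theorem norm_expTwoPiI (z : ℝ) : ‖expTwoPiI z‖ = 1 := by
  rw [expTwoPiI, show (2 * Real.pi * Complex.I * z : ℂ) = ((2 * Real.pi * z : ℝ) : ℂ) * Complex.I by
    push_cast; ring, Complex.norm_exp_ofReal_mul_I]

omit [T2Space M] [IsProbabilityMeasure μ] [BorelSpace M] [IsManifold (𝓡 d) ∞ M] in
theorem IsPeriodicOn.nullMeasurableSet [OpensMeasurableSpace M] (hD : IsPeriodicOn d Φ D n)
    (hμ : IsAbsContLebesgue d μ) (ν : ι) : NullMeasurableSet (D ν) μ :=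
  nullMeasurableSet_of_null_frontier
    (measure_mono_null subset_closure (measure_closure_eq_zero hμ (hD.frontier ν)))

/-- Quantum variance estimate: along eigenvectors whose eigenvalues stay away from the phases of
finitely many periodic domains, the variance of an observable is controlled by the remaining
periodic domains. -/
theorem eventually_variance_le [Countable ι] (hμ : IsAbsContLebesgue d μ)
    (hΦ : IsPiecewiseSmooth d V Φ) (hΦμ : MeasurePreserving Φ μ μ)
    (hOp : IsObservableQuantization d μ Idx Op) (hU : IsMapQuantization d V Φ Idx Op U)
    (hD : IsPeriodicOn d Φ D n) (hUD : IsPeriodicQuantization d V Φ D n α Idx Op U)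
    (herg : Ergodic Φ (μ.restrict (⋃ ν, D ν)ᶜ))
    (hlam : ∀ N j, ‖lam N j‖ = 1)
    (hUφ : ∀ N ∈ Idx, ∀ j : Fin N, Matrix.toEuclideanCLM (𝕜 := ℂ)
      (U N : Matrix (Fin N) (Fin N) ℂ) (φ N j) = lam N j • φ N j)
    (F : Finset ι) {η : ℝ} (hη : 0 < η) (J : ∀ N : ℕ, Finset (Fin N))
    (hJ : ∀ N, ∀ j ∈ J N, ∀ ν ∈ F, η ≤ ‖lam N j ^ n ν - expTwoPiI (n ν * α ν)‖)
    (a : SmoothFun d M) (ha : ∫ x in (⋃ ν, D ν)ᶜ, (a : M → ℂ) x ∂μ = 0)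
    {ε : ℝ} (hε : 0 < ε) :
    ∀ᶠ N in atTopIn Idx, rootMeanSquare (J N) (expectation (φ N) (Op N a)) ≤
      l2Norm μ ((⋃ ν ∈ {ν | ν ∉ F}, D ν).indicator (a : M → ℂ)) + ε := by
  set E : Set M := ⋃ ν ∈ {ν | ν ∉ F}, D ν with hE
  have hDm := hD.nullMeasurableSet hμ
  have hEm : NullMeasurableSet E μ :=
    NullMeasurableSet.biUnion (Set.to_countable _) fun ν _ => hDm ν
  have hD₀m : NullMeasurableSet (⋃ ν, D ν)ᶜ μ := (NullMeasurableSet.iUnion hDm).compl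
  have h1 : (E.indicator (a : M → ℂ)) = fun x => (a : M → ℂ) x - Eᶜ.indicator (a : M → ℂ) x := by
    ext x
    by_cases hx : x ∈ E <;> simp [hx]
  rw [h1]
  refine eventually_seminorm_le_of_annihilator (fun N => expectationSeminorm (φ N) (J N) (Op N))
    (fun a ε hε => ?_) (memLp_indicator_of_nullMeasurableSet hEm.compl (SmoothFun.memLp a 2))
    (fun h hh hann => ?_) a hε
  · filter_upwards [hOp.eventually_hsNorm_le φ a hε] with N hN
    exact (rootMeanSquare_expectation_le _ _ _).trans hN
  have hann' : ∀ b : SmoothFun d M, Tendsto (fun N => rootMeanSquare (J N)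
      (expectation (φ N) (Op N b))) (atTopIn Idx) (𝓝 0) → ∫ x, (b : M → ℂ) x * h x ∂μ = 0 := hann
  have hsmall : ∀ (b : SmoothFun d M) (g : ℕ → ℝ), Tendsto g (atTopIn Idx) (𝓝 0) →
      (∀ᶠ N in atTopIn Idx, ∀ j ∈ J N, ‖expectation (φ N) (Op N b) j‖ ≤ g N) →
      Tendsto (fun N => rootMeanSquare (J N) (expectation (φ N) (Op N b)))
        (atTopIn Idx) (𝓝 0) := by
    intro b g hg hb
    refine squeeze_zero' (Eventually.of_forall fun N => rootMeanSquare_nonneg _ _) ?_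
      (by simpa using hg.abs)
    filter_upwards [hb] with N hN
    refine Real.sqrt_le_iff.2 ⟨abs_nonneg _, ?_⟩
    refine div_le_of_le_mul₀ (by positivity) (by positivity) ?_
    calc ∑ j ∈ J N, ‖expectation (φ N) (Op N b) j‖ ^ 2 ≤ ∑ j ∈ J N, |g N| ^ 2 :=
          Finset.sum_le_sum fun j hj =>
            pow_le_pow_left₀ (norm_nonneg _) ((hN j hj).trans (le_abs_self _)) 2
      _ = (J N).card * |g N| ^ 2 := by simp
      _ ≤ N * |g N| ^ 2 := by
          gcongr
          exact_mod_cast (Finset.card_le_univ _).trans_eq (Fintype.card_fin N)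
      _ = _ := mul_comm _ _
  have hinv : h ∘ Φ =ᵐ[μ] h := by
    obtain ⟨G, hG, hG0, hpull⟩ := exists_isOpen_forall_pullback_pow hμ hΦ hΦμ hU 1
      isClosed_discontinuityDomain.isOpen_compl
      (by rw [compl_compl]; exact hΦ.measure_discontinuityDomain hμ) subset_rfl
    refine ae_eq_comp_of_annihilator (d := d) hh hG hG0 hΦμ fun b hb => ?_
    obtain ⟨c, hc, -, hbc⟩ := hpull b hb
    refine ⟨c, by simpa using hc, hann' _ (hsmall _ _ hbc.tendsto ?_)⟩
    filter_upwards [eventually_mem_atTopIn Idx] with N hN j _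
    rw [map_sub]
    exact norm_expectation_le_of_norm_eq_one (φ N) (hlam N) (hUφ N hN) _ _ j
  -- On the interior of `D ν` within the continuity domain, `(λ ^ n - w) ⟨Op(b)⟩` tends to zero
  -- uniformly and the factor is at least `η`, so such `b` are null functions. The rest of `D ν` has
  -- measure zero.
  have hper : ∀ ν ∈ F, ∀ᵐ x ∂μ, x ∈ D ν → h x = 0 := by
    intro ν hν
    have h2 := ae_eq_zero_of_annihilator hh
      (isOpen_interior.inter (hΦ.isOpen_continuityDomain (Φ := Φ) (n ν)) : IsOpen
        (interior (D ν) ∩ continuityDomain V Φ (n ν))) fun b hb => by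
      have h3 := hUD ν b ((hb.trans Set.inter_subset_left).trans interior_subset) fun k _ hk =>
        (hb.trans Set.inter_subset_right).trans (continuityDomain_anti hk)
      refine hann' _ (hsmall b _ (by simpa using h3.tendsto.div_const η) ?_)
      filter_upwards [eventually_mem_atTopIn Idx] with N hN j hj
      rw [le_div_iff₀ hη, mul_comm]
      calc η * ‖expectation (φ N) (Op N b) j‖
          ≤ ‖lam N j ^ n ν - expTwoPiI (n ν * α ν)‖ * ‖expectation (φ N) (Op N b) j‖ := by
            gcongr; exact hJ N j hj ν hν
        _ = ‖expectation (φ N) ((U N : Matrix (Fin N) (Fin N) ℂ) ^ n ν * Op N b -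
            expTwoPiI (n ν * α ν) • Op N b) j‖ := by
            rw [expectation_sub, expectation_pow_mul (hlam N) (hUφ N hN), expectation_smul,
              ← sub_mul, norm_mul]
        _ ≤ _ := norm_expectation_le_norm _ _ _
    have h4 : ∀ᵐ x ∂μ, x ∉ frontier (D ν) := by
      rw [ae_iff]
      simpa using measure_mono_null subset_closure (measure_closure_eq_zero hμ (hD.frontier ν))
    filter_upwards [h2, h4, show ∀ᵐ x ∂μ, x ∈ continuityDomain V Φ (n ν) from
      hΦ.measure_compl_continuityDomain hμ hΦμ (n ν)] with x hx hxf hxc hxD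
    refine hx ⟨?_, hxc⟩
    by_contra hxi
    exact hxf ⟨subset_closure hxD, hxi⟩
  -- Here ergodicity enters: the invariant `h` is constant on the complement of the periodic
  -- domains, where `a` has integral zero.
  obtain ⟨c, hc⟩ := herg.ae_eq_const_of_ae_eq_comp₀
    (hh.1.aemeasurable.restrict.nullMeasurable) (ae_restrict_of_ae hinv)
  have hc' := (ae_restrict_iff'₀ hD₀m).1 hc
  have h5 : ∀ᵐ x ∂μ, Eᶜ.indicator (a : M → ℂ) x * h x =
      (⋃ ν, D ν)ᶜ.indicator (fun x => (a : M → ℂ) x * c) x := by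
    filter_upwards [hc', (ae_ball_iff F.countable_toSet).2 hper] with x hx hxF
    by_cases hxD : x ∈ (⋃ ν, D ν)ᶜ
    · have hxE : x ∈ Eᶜ := fun hxE => by
        obtain ⟨ν, -, hν⟩ := Set.mem_iUnion₂.1 hxE
        exact hxD (Set.mem_iUnion.2 ⟨ν, hν⟩)
      rw [Set.indicator_of_mem hxD, Set.indicator_of_mem hxE, hx hxD, Function.const_apply]
    · rw [Set.indicator_of_notMem hxD]
      by_cases hxE : x ∈ Eᶜ
      · obtain ⟨ν, hν⟩ := Set.mem_iUnion.1 (not_not.1 hxD)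
        have hνF : ν ∈ F := by
          by_contra hνF
          exact hxE (Set.mem_iUnion₂.2 ⟨ν, hνF, hν⟩)
        rw [hxF ν hνF hν, mul_zero]
      · rw [Set.indicator_of_notMem hxE, zero_mul]
  rw [integral_congr_ae h5, integral_indicator₀ hD₀m, integral_mul_const, ha, zero_mul]

end Variance

/-! ### Quantum ergodicity -/

/-- Diagonal choice of a sequence satisfying countably many decreasing conditions eventually. -/
theorem exists_forall_eventually_of_antitone {l : Filter ℕ} (hl : l ≤ atTop) {X : ℕ → Type*}
    [∀ N, Nonempty (X N)] (P : ℕ → ∀ N, X N → Prop) (hP : ∀ N x, Antitone fun k => P k N x)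
    (h : ∀ k, ∀ᶠ N in l, ∃ x, P k N x) : ∃ x : ∀ N, X N, ∀ k, ∀ᶠ N in l, P k N (x N) := by
  classical
  -- For each `N`, satisfy the strongest condition of index at most `N` that can be satisfied;
  -- antitonicity then gives all the weaker ones.
  have hx : ∀ N, ∃ x : X N, ∀ k ≤ N, (∃ y, P k N y) → P k N x := by
    intro N
    by_cases hN : ∃ k ≤ N, ∃ y, P k N y
    · obtain ⟨k, hk, hy⟩ := hN
      obtain ⟨x, hx⟩ := Nat.findGreatest_spec (P := fun k => ∃ y, P k N y) hk hy
      exact ⟨x, fun k' hk' hy' => hP N x (Nat.le_findGreatest hk' hy') hx⟩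
    · exact ⟨Classical.arbitrary _, fun k hk hy => absurd ⟨k, hk, hy⟩ hN⟩
  choose x hx using hx
  exact ⟨x, fun k => by
    filter_upwards [h k, hl (eventually_ge_atTop k)] with N hN hkN using hx N k hkN hN⟩

section Ergodicity

/-- The average of a function over a set. -/
def setMean {M : Type*} [MeasurableSpace M] (μ : Measure M) (E : Set M) (f : M → ℂ) : ℂ :=
  ((μ.real E)⁻¹ : ℝ) * ∫ x in E, f x ∂μ

theorem norm_setMean_le {M : Type*} [MeasurableSpace M] {μ : Measure M} [IsFiniteMeasure μ]
    {E : Set M} {f : M → ℂ} {c : ℝ} (hc : 0 ≤ c) (hf : ∀ x, ‖f x‖ ≤ c) : ‖setMean μ E f‖ ≤ c := by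
  have h1 := norm_setIntegral_le_of_norm_le_const (measure_lt_top μ E) (fun x _ => hf x)
  rw [setMean, norm_mul, Complex.norm_real, norm_inv, Real.norm_of_nonneg measureReal_nonneg]
  calc (μ.real E)⁻¹ * ‖∫ x in E, f x ∂μ‖ ≤ (μ.real E)⁻¹ * (c * μ.real E) := by gcongr
    _ = c * ((μ.real E)⁻¹ * μ.real E) := by ring
    _ ≤ c := mul_le_of_le_one_right hc inv_mul_le_one

/-- When the set is null, `setMean` is 0 by the convention for inverses and the integral vanishes
anyway, so a null `D₀` needs no separate treatment later. -/
theorem setIntegral_sub_setMean {M : Type*} [MeasurableSpace M] {μ : Measure M} [IsFiniteMeasure μ]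
    {E : Set M} {f : M → ℂ} (hf : Integrable f μ) : ∫ x in E, (f x - setMean μ E f) ∂μ = 0 := by
  rcases eq_or_ne (μ.real E) 0 with h | h
  · rw [Measure.restrict_eq_zero.2 ((measureReal_eq_zero_iff).1 h), integral_zero_measure]
  · rw [integral_sub hf.integrableOn (integrable_const _)]
    simp only [integral_const, measureReal_restrict_apply_univ, setMean, Complex.real_smul]
    rw [← mul_assoc, ← Complex.ofReal_mul, mul_inv_cancel₀ h]
    simp

theorem exists_finset_measureReal_iUnion_lt {M ι : Type*} [MeasurableSpace M] {μ : Measure M}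
    [IsFiniteMeasure μ] [Countable ι] {D : ι → Set M} (hD : ∀ ν, NullMeasurableSet (D ν) μ)
    (hdisj : Pairwise fun ν ν' => Disjoint (D ν) (D ν')) {ε : ℝ} (hε : 0 < ε) :
    ∃ F : Finset ι, μ.real (⋃ ν ∈ {ν | ν ∉ F}, D ν) < ε := by
  have h1 : ∑' ν, μ (D ν) ≠ ⊤ := by
    rw [← measure_iUnion₀ (fun ν ν' h => (hdisj h).aedisjoint) hD]
    exact measure_ne_top _ _
  obtain ⟨F, hF⟩ := ((ENNReal.tendsto_tsum_compl_atTop_zero h1).eventually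
    (gt_mem_nhds (ENNReal.ofReal_pos.2 hε))).exists
  refine ⟨F, ?_⟩
  exact ENNReal.toReal_lt_of_lt_ofReal
    ((measure_biUnion_le μ (Set.to_countable {ν | ν ∉ F}) D).trans_lt hF)

variable {d : ℕ} {M : Type*} [TopologicalSpace M] [T2Space M] [CompactSpace M]
  [ChartedSpace (EuclideanSpace ℝ (Fin d)) M] [MeasurableSpace M] [BorelSpace M]
  {μ : Measure M} [IsProbabilityMeasure μ] {Idx : Set ℕ}
  {Op : ∀ N : ℕ, SmoothFun d M →ₗ[ℂ] Matrix (Fin N) (Fin N) ℂ}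
  {U : ∀ N : ℕ, Matrix.unitaryGroup (Fin N) ℂ}
  {φ : ∀ N : ℕ, OrthonormalBasis (Fin N) ℂ (EuclideanSpace ℂ (Fin N))}
  {lam : ∀ N : ℕ, Fin N → ℂ}
  [IsManifold (𝓡 d) ∞ M] {κ : Type*} {V : κ → Set M} {Φ : Equiv.Perm M}
  {ι : Type*} {D : ι → Set M} {n : ι → ℕ} {α : ι → ℝ}

/-- Discarding the eigenvalues near the phases of finitely many domains costs at most `1 - μ(D₀) +
ε/2`; Chebyshev's inequality discards at most another `ε/2` among the rest. -/
theorem eventually_exists_card_ge [Countable ι] (hμ : IsAbsContLebesgue d μ)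
    (hΦ : IsPiecewiseSmooth d V Φ) (hΦμ : MeasurePreserving Φ μ μ)
    (hOp : IsObservableQuantization d μ Idx Op) (hU : IsMapQuantization d V Φ Idx Op U)
    (hD : IsPeriodicOn d Φ D n) (hUD : IsPeriodicQuantization d V Φ D n α Idx Op U)
    (herg : Ergodic Φ (μ.restrict (⋃ ν, D ν)ᶜ))
    (hlam : ∀ N j, ‖lam N j‖ = 1)
    (hUφ : ∀ N ∈ Idx, ∀ j : Fin N, Matrix.toEuclideanCLM (𝕜 := ℂ)
      (U N : Matrix (Fin N) (Fin N) ℂ) (φ N j) = lam N j • φ N j)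
    (A : Finset (SmoothFun d M)) {ε : ℝ} (hε : 0 < ε) :
    ∀ᶠ N : ℕ in atTopIn Idx, ∃ J : Finset (Fin N), μ.real (⋃ ν, D ν)ᶜ - ε ≤ (J.card : ℝ) / N ∧
      ∀ a ∈ A, ∀ j ∈ J,
        ‖expectation (φ N) (Op N a) j - setMean μ (⋃ ν, D ν)ᶜ (a : M → ℂ)‖ < ε := by
  classical
  have hDm := hD.nullMeasurableSet hμ
  have hD₀m : NullMeasurableSet (⋃ ν, D ν)ᶜ μ := (NullMeasurableSet.iUnion hDm).compl
  set D₀ := (⋃ ν, D ν)ᶜ with hD₀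
  let m : SmoothFun d M → ℂ := fun a => setMean μ D₀ (a : M → ℂ)
  let z : SmoothFun d M → SmoothFun d M := fun a => a - m a • 1
  have hz : ∀ a x, (z a : M → ℂ) x = (a : M → ℂ) x - m a := fun a x => by simp [z]
  obtain ⟨t, ht, htA⟩ : ∃ t : ℝ, 0 < t ∧ A.card * (3 * t / ε) ^ 2 ≤ ε / 2 := by
    have h1 : Tendsto (fun t : ℝ => A.card * (3 * t / ε) ^ 2) (𝓝[>] 0) (𝓝 0) := by
      have : Continuous fun t : ℝ => A.card * (3 * t / ε) ^ 2 := by fun_prop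
      simpa using (this.tendsto 0).mono_left nhdsWithin_le_nhds
    obtain ⟨t, h2, h3⟩ := ((h1.eventually (gt_mem_nhds (half_pos hε))).and
      self_mem_nhdsWithin).exists
    exact ⟨t, h3, h2.le⟩
  obtain ⟨c, hc, hcA⟩ : ∃ c : ℝ, 0 < c ∧ ∀ a ∈ A, ∀ x, ‖(z a : M → ℂ) x‖ ≤ c := by
    choose b hb0 hb using fun a : SmoothFun d M => SmoothFun.exists_norm_lt (z a)
    refine ⟨1 + ∑ a ∈ A, b a, ?_, fun a ha x => (hb a x).le.trans ?_⟩
    · have := Finset.sum_nonneg fun a (_ : a ∈ A) => (hb0 a).le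
      positivity
    · have := Finset.single_le_sum (fun a _ => (hb0 a).le) ha
      linarith
  -- `F` must leave so little periodic measure that every centred observable, bounded by `c`, has
  -- `L²` norm at most `t` there.
  obtain ⟨F, hF⟩ := exists_finset_measureReal_iUnion_lt hDm hD.disjoint
    (show 0 < (t / (2 * c)) ^ 2 by positivity)
  have hfix : ∀ m, 1 ≤ m → μ {x | x ∈ D₀ ∧ (Φ ^ m) x = x} = 0 := fun m hm =>
    measure_mono_null subset_closure (measure_closure_eq_zero hμ
      (by have h := hD.fixed_compl m (by omega); rwa [zpow_natCast] at h))
  obtain ⟨η, hη, hcount⟩ := exists_eventually_card_filter_div_le hμ hΦ hΦμ hOp hU hD₀m hfix hlam hUφ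
    F hD.pos (w := fun ν => expTwoPiI (n ν * α ν)) (fun ν => norm_expTwoPiI _) (half_pos hε)
  let J : ∀ N : ℕ, Finset (Fin N) := fun N =>
    (Finset.univ.filter fun j => ∃ ν ∈ F, ‖lam N j ^ n ν - expTwoPiI (n ν * α ν)‖ < η)ᶜ
  have hJ : ∀ N, ∀ j ∈ J N, ∀ ν ∈ F, η ≤ ‖lam N j ^ n ν - expTwoPiI (n ν * α ν)‖ := by
    intro N j hj ν hν
    by_contra! h
    exact Finset.mem_compl.1 hj (Finset.mem_filter.2 ⟨Finset.mem_univ _, ν, hν, h⟩)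
  have hvar : ∀ᶠ N in atTopIn Idx, ∀ a ∈ A,
      rootMeanSquare (J N) (fun j => expectation (φ N) (Op N a) j - m a) ≤ 3 * t := by
    refine (eventually_all_finset _).2 fun a ha => ?_
    have h1 := eventually_variance_le hμ hΦ hΦμ hOp hU hD hUD herg hlam hUφ F hη J hJ (z a)
      (by simp_rw [hz]; exact setIntegral_sub_setMean ((SmoothFun.memLp a 1).integrable le_rfl)) ht
    have h2 : l2Norm μ ((⋃ ν ∈ {ν | ν ∉ F}, D ν).indicator (z a : M → ℂ)) ≤ t := by
      refine (l2Norm_indicator_le (NullMeasurableSet.biUnion (Set.to_countable _)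
        fun ν _ => hDm ν) hc.le (hcA a ha)).trans ?_
      calc c * √(μ.real (⋃ ν ∈ {ν | ν ∉ F}, D ν)) ≤ c * √((t / (2 * c)) ^ 2) := by gcongr
        _ = t / 2 := by rw [Real.sqrt_sq (by positivity)]; field_simp
        _ ≤ t := by linarith
    have h3 := ((hOp.tendsto_hsNorm_one_sub φ).const_mul ‖m a‖).eventually
      (gt_mem_nhds (by simpa using ht))
    filter_upwards [h1.mono fun N h => h.trans (add_le_add_left h2 t), h3] with N h1 h3
    -- Centring by the function 1 quantizes to `Op(1)` rather than the identity. The correction is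
    -- the third `t`; the other two come from the variance estimate.
    have h4 : (fun j => expectation (φ N) (Op N a) j - m a) = fun j =>
        expectation (φ N) (Op N (z a)) j + (-m a) • expectation (φ N) (1 - Op N 1) j := by
      ext j
      simp only [z, map_sub, map_smul, expectation_sub, expectation_smul, expectation_one,
        smul_eq_mul]
      ring
    rw [h4]
    refine (rootMeanSquare_add_le _ _ _).trans ?_
    rw [rootMeanSquare_smul, norm_neg]
    have h5 : ‖m a‖ * rootMeanSquare (J N) (expectation (φ N) (1 - Op N 1)) ≤
        ‖m a‖ * hsNorm (φ N) (1 - Op N 1) := by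
      gcongr; exact rootMeanSquare_expectation_le _ _ _
    linarith
  filter_upwards [hvar, hcount, eventually_ne_zero_atTopIn Idx] with N hvar hcount hN
  have hN' : (0 : ℝ) < N := by positivity
  let bad : SmoothFun d M → Finset (Fin N) := fun a =>
    (J N).filter fun j => ε ≤ ‖expectation (φ N) (Op N a) j - m a‖
  refine ⟨J N \ A.biUnion bad, ?_, fun a ha j hj => ?_⟩
  · have h1 : (((A.biUnion bad).card : ℝ)) / N ≤ ε / 2 := by
      calc ((A.biUnion bad).card : ℝ) / N ≤ (∑ a ∈ A, ((bad a).card : ℝ)) / N := by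
            gcongr; exact_mod_cast Finset.card_biUnion_le
        _ ≤ ∑ a ∈ A, (3 * t / ε) ^ 2 := by
            rw [Finset.sum_div]
            refine Finset.sum_le_sum fun a ha => (card_filter_le_div_le _ _ hε).trans ?_
            have := rootMeanSquare_nonneg (J N) (fun j => expectation (φ N) (Op N a) j - m a)
            have := hvar a ha
            gcongr
        _ ≤ ε / 2 := by simpa using htA
    have h2 : (N : ℝ) - ((Finset.univ.filter fun j =>
        ∃ ν ∈ F, ‖lam N j ^ n ν - expTwoPiI (n ν * α ν)‖ < η).card : ℝ) = (J N).card := by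
      rw [Finset.card_compl, Fintype.card_fin, Nat.cast_sub]
      exact (Finset.card_le_univ _).trans_eq (Fintype.card_fin N)
    have h3 : ((J N).card : ℝ) - (A.biUnion bad).card ≤ (J N \ A.biUnion bad).card := by
      have := Finset.le_card_sdiff (A.biUnion bad) (J N)
      rw [sub_le_iff_le_add]
      exact_mod_cast Nat.sub_le_iff_le_add.1 this
    rw [div_le_iff₀ hN'] at h1 hcount
    rw [le_div_iff₀ hN']
    linarith
  · obtain ⟨hjJ, hjb⟩ := Finset.mem_sdiff.1 hj
    by_contra! h
    exact hjb (Finset.mem_biUnion.2 ⟨a, ha, Finset.mem_filter.2 ⟨hjJ, h⟩⟩)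

end Ergodicity

theorem exists_subset_hasDensity {Idx : Set ℕ} {J : ∀ N : ℕ, Finset (Fin N)} {δ : ℝ} (hδ : 0 ≤ δ)
    (hJ : ∀ k : ℕ, ∀ᶠ N : ℕ in atTopIn Idx, δ - 1 / (k + 1) ≤ ((J N).card : ℝ) / N) :
    ∃ J' : ∀ N : ℕ, Finset (Fin N), (∀ N, J' N ⊆ J N) ∧ HasDensity Idx J' δ := by
  -- Only a lower bound on the density is available, so the sets are cut down to at most `⌊δ N⌋`
  -- elements; this keeps the lower bound up to the floor error and forces the upper one.
  choose J' hJ' hcard using fun N : ℕ => Finset.exists_subset_card_eq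
    (min_le_left (J N).card ⌊δ * N⌋₊)
  refine ⟨J', hJ', ?_⟩
  refine tendsto_order.2 ⟨fun b hb => ?_, fun b hb => ?_⟩
  · obtain ⟨k, hk⟩ := exists_nat_one_div_lt (sub_pos.2 hb)
    filter_upwards [hJ k, (eventually_gt_atTop (k + 1)).filter_mono inf_le_left] with N h1 h2
    have hN : (0 : ℝ) < N := by exact_mod_cast (Nat.succ_pos k).trans h2
    have hk2 : (k : ℝ) + 1 < N := by exact_mod_cast h2
    rw [hcard, lt_div_iff₀ hN, Nat.cast_min]
    rw [le_div_iff₀ hN] at h1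
    have hkp : (0 : ℝ) < k + 1 := by positivity
    have h5 : 1 < 1 / ((k : ℝ) + 1) * N := by
      rw [one_div_mul_eq_div, lt_div_iff₀ hkp]; linarith
    refine lt_min ?_ ?_
    · nlinarith
    · have h4 := Nat.lt_floor_add_one (δ * N)
      nlinarith
  · filter_upwards [eventually_ne_zero_atTopIn Idx] with N hN
    have hN' : (0 : ℝ) < N := by positivity
    refine lt_of_le_of_lt ?_ hb
    rw [hcard, div_le_iff₀ hN']
    exact (Nat.cast_le.2 (min_le_right _ _)).trans (Nat.floor_le (by positivity))

end

theorem mainTheorem8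
    (d : ℕ) {M : Type*} [TopologicalSpace M] [T2Space M] [CompactSpace M]
    [ChartedSpace (EuclideanSpace ℝ (Fin d)) M] [IsManifold (𝓡 d) ∞ M]
    [MeasurableSpace M] [BorelSpace M]
    (μ : Measure M) [IsProbabilityMeasure μ] (hμ : IsAbsContLebesgue d μ)
    -- the classical map
    {κ : Type*} [Countable κ] (V : κ → Set M) (Φ : Equiv.Perm M)
    (hΦ : IsPiecewiseSmooth d V Φ) (hΦμ : MeasurePreserving Φ μ μ)
    -- the quantum observables and the quantum map
    (Idx : Set ℕ) (hIdx : Idx.Infinite)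
    (Op : ∀ N : ℕ, SmoothFun d M →ₗ[ℂ] Matrix (Fin N) (Fin N) ℂ)
    (hOp : IsObservableQuantization d μ Idx Op)
    (U : ∀ N : ℕ, Matrix.unitaryGroup (Fin N) ℂ)
    (hU : IsMapQuantization d V Φ Idx Op U)
    -- the periodic domains, and the ergodic remaining set
    {ι : Type*} [Countable ι] (D : ι → Set M) (n : ι → ℕ) (α : ι → ℝ)
    (hD : IsPeriodicOn d Φ D n)
    (hUD : IsPeriodicQuantization d V Φ D n α Idx Op U)
    (D₀ : Set M) (hD₀ : D₀ = (⋃ ν, D ν)ᶜ)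
    (herg : Ergodic Φ (μ.restrict D₀))
    -- orthonormal bases of eigenstates of the quantum map
    (φ : ∀ N : ℕ, OrthonormalBasis (Fin N) ℂ (EuclideanSpace ℂ (Fin N)))
    (θ : ∀ N : ℕ, Fin N → ℝ)
    (hφ : ∀ N ∈ Idx, ∀ j : Fin N,
      Matrix.toEuclideanCLM (𝕜 := ℂ) (U N : Matrix (Fin N) (Fin N) ℂ) (φ N j) =
        expTwoPiI (θ N j) • φ N j) :
    ∃ J : ∀ N : ℕ, Finset (Fin N),
      HasDensity Idx J (μ.real D₀) ∧
      ∀ a : SmoothFun d M, ∀ ε : ℝ, 0 < ε →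
        ∀ᶠ N in atTopIn Idx, ∀ j ∈ J N,
          ‖inner ℂ (φ N j) (Matrix.toEuclideanCLM (𝕜 := ℂ) (Op N a) (φ N j)) -
            ((μ.real D₀)⁻¹ : ℝ) * ∫ x in D₀, (a : M → ℂ) x ∂μ‖ < ε := by
  subst hD₀
  have hlam : ∀ N (j : Fin N), ‖expTwoPiI (θ N j)‖ = 1 := fun N j => norm_expTwoPiI _
  obtain ⟨T, -, hT, hdense⟩ := SmoothFun.exists_countable_dense (Set.univ : Set (SmoothFun d M))
  obtain ⟨b₀, hb₀, -⟩ := hdense 0 (Set.mem_univ _) 1 one_pos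
  obtain ⟨f, rfl⟩ := hT.exists_eq_range ⟨b₀, hb₀⟩
  classical
  obtain ⟨J, hJ⟩ := exists_forall_eventually_of_antitone (l := atTopIn Idx) inf_le_left
    (X := fun N => Finset (Fin N))
    (fun k N J => μ.real (⋃ ν, D ν)ᶜ - 1 / ((k : ℝ) + 1) ≤ (J.card : ℝ) / N ∧
      ∀ i < k, ∀ j ∈ J, ‖expectation (φ N) (Op N (f i)) j -
        setMean μ (⋃ ν, D ν)ᶜ (f i : M → ℂ)‖ < 1 / ((k : ℝ) + 1))
    (fun N J k l hkl h => by
      have h1 : 1 / ((l : ℝ) + 1) ≤ 1 / ((k : ℝ) + 1) := by gcongr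
      exact ⟨by linarith [h.1], fun i hi j hj => (h.2 i (hi.trans_le hkl) j hj).trans_le h1⟩)
    (fun k => by
      filter_upwards [eventually_exists_card_ge hμ hΦ hΦμ hOp hU hD hUD herg hlam hφ
        ((Finset.range k).image f) (show 0 < 1 / ((k : ℝ) + 1) by positivity)] with N hN
      obtain ⟨J, hJ1, hJ2⟩ := hN
      exact ⟨J, hJ1, fun i hi => hJ2 _ (Finset.mem_image_of_mem f (Finset.mem_range.2 hi))⟩)
  obtain ⟨J', hJ'J, hJ'⟩ := exists_subset_hasDensity measureReal_nonneg
    fun k => (hJ k).mono fun N h => h.1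
  refine ⟨J', hJ', fun a ε hε => ?_⟩
  -- Error budget: `5 · ε/8` for the operator norm of `Op(a - f i)`, `ε/4` for the approximant, and
  -- `ε/8` for the difference of means. The index `max k (i + 1)` is large enough both for precision
  -- `ε/4` and for `f i` to be among the controlled observables.
  obtain ⟨_, ⟨i, rfl⟩, hi⟩ := hdense a (Set.mem_univ _) (ε / 8) (by positivity)
  obtain ⟨k, hk⟩ := exists_nat_one_div_lt (show 0 < ε / 4 by positivity)
  filter_upwards [hJ (max k (i + 1)), hOp.eventually_norm_le (a - f i) (by positivity) hi]
    with N hN hbound j hj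
  have h1 := hN.2 i (lt_max_of_lt_right (Nat.lt_succ_self i)) j (hJ'J N hj)
  have h2 : 1 / (((max k (i + 1) : ℕ) : ℝ) + 1) ≤ 1 / ((k : ℝ) + 1) := by
    gcongr
    exact le_max_left _ _
  have h3 := (norm_expectation_le_norm (φ N) (Op N (a - f i)) j).trans hbound
  have h4 : ‖setMean μ (⋃ ν, D ν)ᶜ ((a - f i : SmoothFun d M) : M → ℂ)‖ ≤ ε / 8 :=
    norm_setMean_le (by positivity) fun x => (hi x).le
  have h5 : setMean μ (⋃ ν, D ν)ᶜ ((a - f i : SmoothFun d M) : M → ℂ) =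
      setMean μ (⋃ ν, D ν)ᶜ (a : M → ℂ) - setMean μ (⋃ ν, D ν)ᶜ (f i : M → ℂ) := by
    rw [setMean, setMean, setMean, ← mul_sub, ← integral_sub]
    · rfl
    · exact ((SmoothFun.memLp a 1).integrable le_rfl).integrableOn
    · exact ((SmoothFun.memLp (f i) 1).integrable le_rfl).integrableOn
  change ‖expectation (φ N) (Op N a) j - setMean μ (⋃ ν, D ν)ᶜ (a : M → ℂ)‖ < ε
  have h6 : expectation (φ N) (Op N a) j - setMean μ (⋃ ν, D ν)ᶜ (a : M → ℂ) =
      expectation (φ N) (Op N (a - f i)) j +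
        (expectation (φ N) (Op N (f i)) j - setMean μ (⋃ ν, D ν)ᶜ (f i : M → ℂ)) +
        -setMean μ (⋃ ν, D ν)ᶜ ((a - f i : SmoothFun d M) : M → ℂ) := by
    rw [h5, map_sub, expectation_sub]
    ring
  rw [h6]
  refine norm_add₃_le.trans_lt ?_
  rw [norm_neg]
  linarith
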